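/- Consider a layered binary linear relay network with $M\ge 2$ hops and layers $1,\dots,M+1$, layer $m$ having $K_m\ge 1$ nodes, where $K_1=K_{M+1}=K$; source $k$ is the $k$-th node of layer $1$ and its destination is the $k$-th node of layer $M+1$. At each time $t$ the vector $\mathbf{x}_m[t]\in\mathbb{F}_2^{K_m}$ sent by layer $m$ is received by layer $m+1$ as $\mathbf{y}_m[t]=\mathbf{H}_m[t]\,\mathbf{x}_m[t]$, where the entries of all channel matrices $\mathbf{H}_m[t]\in\mathbb{F}_2^{K_{m+1}\times K_m}$ are independent over entries, hops $m$ and times $t$, and each equals $1$ with probability $1/2$. At time $t$ the nodes of layer $m\le M$ know $\mathbf{H}_l[s]$ for $l\le m$ and $s\le t$; the destinations know all channel matrices. In a code of length $n$ with rates $R_1,\dots,R_K\ge 0$, source $k$ has a message $W_k$ of $\lfloor nR_k\rfloor$ bits; the messages are uniform and independent of each other and of the channels. The symbol sent by source $k$ at time $t$ is a function of $W_k$ and of its channel knowledge; the symbol sent by a relay at time $t$ is a function of the symbols that it received at times $1,\dots,t-1$ and of its channel knowledge; destination $k$ estimates $W_k$ from its $n$ received symbols and the channel matrices. The rates $(R_1,\dots,R_K)$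 are achievable if there are codes of lengths $n=1,2,\dots$ with these rates whose error probability at every destination tends to $0$ as $n\to\infty$. The sum capacity $C_{\mathrm{sum}}$ is the supremum of $\sum_{k=1}^K R_k$ over all achievable rates. Suppose that the network has a minimum-dimensional bottleneck hop $m_0$, that is, $m_0$ minimizes $\mathbb{E}[\operatorname{rank}\mathbf{H}_m]$ over $m\in\{1,\dots,M\}$, and for every $m\in\{1,\dots,M\}$ either $K_m\ge K_{m_0}$ and $K_{m+1}\ge K_{m_0+1}$, or $K_m\ge K_{m_0+1}$ and $K_{m+1}\ge K_{m_0}$. Then $$C_{\mathrm{sum}}=2^{-K_{m_0+1}K_{m_0}}\sum_{\mathbf{H}\in\mathbb{F}_2^{K_{m_0+1}\times K_{m_0}}}\operatorname{rank}(\mathbf{H})=\mathbb{E}[\operatorname{rank}\mathbf{H}_{m_0}].$$ -/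

import Mathlib

open scoped Matrix

/-- A layered linear finite-field relay network over `𝔽₂` with `M` hops. The layers are numbered
`0, …, M` and layer `m` has `K m` nodes (the values `K m` for `m > M` play no role). Hop `m`, for
`m < M`, goes from layer `m` to layer `m + 1`. Layer `0` consists of the sources and layer `M` of
the destinations, source `k` being paired with destination `k`. The channel coefficient from node
`i` of layer `m` to node `j` of layer `m + 1` equals `1` with probability `p m j i`. -/
structure RelayNetwork where
  M : ℕ
  M_pos : 0 < M
  K : ℕ → ℕ
  K_pos : ∀ m, m ≤ M → 0 < K m
  K_last : K M = K 0
  p : (m : Fin M) → Fin (K (m + 1)) → Fin (K m) → ℝ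
  p_nonneg : ∀ m j i, 0 ≤ p m j i
  p_le_one : ∀ m j i, p m j i ≤ 1

namespace RelayNetwork

/-- Channel matrices of hop `m`: row = receiver in layer `m + 1`, column = transmitter in
layer `m`. -/
abbrev HopMatrix (N : RelayNetwork) (m : Fin N.M) : Type :=
  Matrix (Fin (N.K (m + 1))) (Fin (N.K m)) (ZMod 2)

/-- Probability that the channel matrix of hop `m` (independent Bernoulli entries) equals `A`. -/
noncomputable def hopProb (N : RelayNetwork) (m : Fin N.M) (A : N.HopMatrix m) : ℝ :=
  ∏ j, ∏ i, if A j i = 1 then N.p m j i else 1 - N.p m j i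

/-- The expected rank of the channel matrix of hop `m`. -/
noncomputable def avgRank (N : RelayNetwork) (m : Fin N.M) : ℝ :=
  ∑ A : N.HopMatrix m, N.hopProb m A * (A.rank : ℝ)

/-- Hop `m₀` is a bottleneck: it minimises the expected rank of the channel matrix. -/
def IsBottleneckHop (N : RelayNetwork) (m₀ : Fin N.M) : Prop :=
  ∀ m, N.avgRank m₀ ≤ N.avgRank m

/-- Hop `m₀` is a minimum-dimensional bottleneck hop: it is a bottleneck hop, and every hop
contains at least as many transmitters and receivers as hop `m₀`, possibly after exchanging the
roles of the two ends of hop `m₀` (the choice may depend on the hop). -/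
def IsMinDimBottleneckHop (N : RelayNetwork) (m₀ : Fin N.M) : Prop :=
  N.IsBottleneckHop m₀ ∧
    ∀ m : Fin N.M,
      (N.K m₀ ≤ N.K m ∧ N.K (m₀ + 1) ≤ N.K (m + 1)) ∨
      (N.K (m₀ + 1) ≤ N.K m ∧ N.K m₀ ≤ N.K (m + 1))

/-- A realization of all the channel matrices during `n` channel uses. -/
abbrev Channel (N : RelayNetwork) (n : ℕ) : Type :=
  (t : Fin n) → (m : Fin N.M) → N.HopMatrix m

/-- The probability of a channel realization: independent over time and over hops. -/
noncomputable def channelProb (N : RelayNetwork) {n : ℕ} (H : N.Channel n) : ℝ :=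
  ∏ t, ∏ m, N.hopProb m (H t m)

/-- The channel state information held at time `t` by a transmitter of hop `m`: the matrices of
the hops `0, …, m` at the times up to and including `t`. -/
abbrev CSI (N : RelayNetwork) {n : ℕ} (m : Fin N.M) (t : Fin n) : Type :=
  (s : {s : Fin n // s ≤ t}) → (l : {l : Fin N.M // l ≤ m}) → N.HopMatrix l

/-- The channel state information extracted from a channel realization. -/
def csi (N : RelayNetwork) {n : ℕ} (H : N.Channel n) (m : Fin N.M) (t : Fin n) : N.CSI m t :=
  fun s l => H s l

/-- A block code of length `n` in which source `k` has a message of `L k` bits, i.e. `2 ^ L k`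
messages. A source encodes its own message; a relay uses its own strictly past received symbols;
a destination decodes from its `n` received symbols. Transmitters know the channel matrices
causally, up to the hop on which they transmit; destinations know all of them. -/
structure Code (N : RelayNetwork) (n : ℕ) (L : Fin (N.K 0) → ℕ) where
  /-- symbol sent by source `k` at time `t` -/
  enc : (k : Fin (N.K 0)) → (t : Fin n) → Fin (2 ^ L k) → N.CSI ⟨0, N.M_pos⟩ t → ZMod 2
  /-- symbol sent by the relay `k` of layer `m + 1` at time `t` -/
  relay : (m : ℕ) → (hm : m + 1 < N.M) → Fin (N.K (m + 1)) → (t : Fin n) →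
    ({s : Fin n // s < t} → ZMod 2) → N.CSI ⟨m + 1, hm⟩ t → ZMod 2
  /-- message estimate of destination `k` -/
  dec : (k : Fin (N.K 0)) → (Fin n → ZMod 2) → N.Channel n → Fin (2 ^ L k)

namespace Code

variable {N : RelayNetwork} {n : ℕ} {L : Fin (N.K 0) → ℕ}

/-- The vector sent by the nodes of layer `m < M` at time `t`, for the messages `w` and the
channel realization `H`. A relay `k` of layer `m + 1` has received at time `s` the symbol
`(H s m *ᵥ x) k`, where `x` is the vector sent by layer `m` at time `s`. -/
def transmit (c : N.Code n L) (w : (k : Fin (N.K 0)) → Fin (2 ^ L k)) (H : N.Channel n) :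
    (m : ℕ) → m < N.M → Fin n → Fin (N.K m) → ZMod 2
  | 0, hm, t => fun k => c.enc k t (w k) (N.csi H ⟨0, hm⟩ t)
  | m + 1, hm, t => fun k =>
      c.relay m hm k t
        (fun s => (H s ⟨m, Nat.lt_of_succ_lt hm⟩ *ᵥ
          transmit c w H m (Nat.lt_of_succ_lt hm) s) k)
        (N.csi H ⟨m + 1, hm⟩ t)

/-- The vector received at time `t` on hop `m` (by the nodes of layer `m + 1`). -/
def received (c : N.Code n L) (w : (k : Fin (N.K 0)) → Fin (2 ^ L k)) (H : N.Channel n)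
    (m : Fin N.M) (t : Fin n) : Fin (N.K (m + 1)) → ZMod 2 :=
  H t m *ᵥ c.transmit w H m m.isLt t

/-- The last hop. -/
def lastHop (N : RelayNetwork) : Fin N.M := ⟨N.M - 1, Nat.sub_lt N.M_pos Nat.one_pos⟩

theorem K_lastHop (N : RelayNetwork) : N.K 0 = N.K (lastHop N + 1) := by
  have h : ((lastHop N : Fin N.M) : ℕ) + 1 = N.M := Nat.sub_add_cancel N.M_pos
  rw [h, N.K_last]

/-- The message decoded by destination `k`. -/
def decoded (c : N.Code n L) (w : (k : Fin (N.K 0)) → Fin (2 ^ L k)) (H : N.Channel n)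
    (k : Fin (N.K 0)) : Fin (2 ^ L k) :=
  c.dec k (fun t => c.received w H (lastHop N) t (Fin.cast (K_lastHop N) k)) H

/-- The probability of error at destination `k`; the messages are independent of each other and
of the channel, and uniformly distributed. -/
noncomputable def errorProb (c : N.Code n L) (k : Fin (N.K 0)) : ℝ :=
  (∑ w : (k : Fin (N.K 0)) → Fin (2 ^ L k), ∑ H : N.Channel n,
      if c.decoded w H k ≠ w k then N.channelProb H else 0) /
    (Fintype.card ((k : Fin (N.K 0)) → Fin (2 ^ L k)) : ℝ)

end Code

/-- The rates `R k` (bits per channel use) are achievable: there are codes of every length `n`, in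
which source `k` sends `⌊n R k⌋` bits, whose error probability tends to `0` at every
destination. -/
def Achievable (N : RelayNetwork) (R : Fin (N.K 0) → ℝ) : Prop :=
  (∀ k, 0 ≤ R k) ∧
    ∃ c : (n : ℕ) → N.Code n (fun k => ⌊(n : ℝ) * R k⌋₊),
      ∀ k, Filter.Tendsto (fun n => (c n).errorProb k) Filter.atTop (nhds 0)

/-- `C` is the sum capacity: the supremum of the achievable sum-rates. -/
def IsSumCapacity (N : RelayNetwork) (C : ℝ) : Prop :=
  IsLUB {S : ℝ | ∃ R : Fin (N.K 0) → ℝ, N.Achievable R ∧ S = ∑ k, R k} C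

end RelayNetwork

/-! Converse. Fix the channel. What is received on a hop during `n` uses lies in a product of column
spaces with `2 ^ ∑ rank` elements and determines everything downstream, so at most that many message
tuples are decoded correctly (`Code.card_decoded_le`). The sum of the ranks exceeds `n (E rank + δ)`
only with exponentially small probability, hence `Achievable.sum_le_avgRank`, in particular at hop
`m₀`.

Achievability. Relays merely forward single received bits, so the channel itself has to undo the
mixing. A packet of order `r` has `r` ordered active nodes in every layer and waits at each hop for
a prescribed channel matrix; these matrices are such that the `r × r` blocks between consecutive
active tuples multiply to the identity, and the packet then delivers `r` bits without interference.
By `achievable_of_packet_types`, a weighting of such packet types is served at any fraction `θ < 1`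
of its full rate if its marginal on every hop is at most the channel law.

The weighting comes from a coupling (`exists_hopWeights`). Let `b × a` be the size of the matrix of
hop `m₀`. In a uniform matrix that is large enough, pick a random `b × a` submatrix (or `a × b`,
which has the same rank law), let `r` be its rank and pick in it a nonsingular `r × r` block. Given
`r`, the block is uniform on the invertible matrices and independent of its uniform position. This
can be read backwards: draw `r`, then independent uniform active tuples and invertible matrices
`P_l` for the layers, the destinations sharing the state of the sources, and finally the matrix of
each hop conditioned on its block being `P_{l+1} P_l⁻¹`. Since `M ≥ 2`, the states at the two ends
of a hop are independent, so the marginals fit the channel law; the blocks telescope to `1`. The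
rate obtained is `E r = E rank H_{m₀}`. -/

namespace RelayNetwork

/-! ### Expectations under product weights. -/

section ProductSums

variable {ι : Type*} [Fintype ι] [DecidableEq ι] {α : ι → Type*}

/-- Turns a function of one coordinate into a product over all coordinates, so that sums of products
factor by `Fintype.prod_sum`. -/
theorem prod_dite_apply (i : ι) (φ : α i → ℝ) (x : ∀ i, α i) :
    (∏ k, if h : i = k then φ (h ▸ x k) else 1) = φ (x i) := by
  rw [Finset.prod_dite_eq]
  simp

variable [∀ i, Fintype (α i)]

/-- Expectation of a function of one coordinate under a product weight. -/
theorem sum_prod_mul_apply (f : ∀ i, α i → ℝ) (hf : ∀ i, ∑ a, f i a = 1) (i : ι) (φ : α i → ℝ) :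
    ∑ x : ∀ i, α i, (∏ j, f j (x j)) * φ (x i) = ∑ a, f i a * φ a := by
  have h1 : ∀ x : ∀ i, α i, (∏ j, f j (x j)) * φ (x i) =
      ∏ k, f k (x k) * (if h : i = k then φ (h ▸ x k) else 1) := by
    intro x
    rw [Finset.prod_mul_distrib, prod_dite_apply]
  rw [Finset.sum_congr rfl fun x _ => h1 x,
    ← Fintype.prod_sum (fun k a => f k a * (if h : i = k then φ (h ▸ a) else 1)),
    Fintype.prod_eq_single i]
  · simp
  · intro k hk
    simp [hk.symm, hf]

/-- Expectation of a product of functions of two coordinates under a product weight. -/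
theorem sum_prod_mul_apply_mul_apply (f : ∀ i, α i → ℝ) (hf : ∀ i, ∑ a, f i a = 1) {i j : ι}
    (hij : i ≠ j) (φ : α i → ℝ) (ψ : α j → ℝ) :
    ∑ x : ∀ i, α i, (∏ k, f k (x k)) * (φ (x i) * ψ (x j)) =
      (∑ a, f i a * φ a) * ∑ b, f j b * ψ b := by
  have h1 : ∀ x : ∀ i, α i, (∏ k, f k (x k)) * (φ (x i) * ψ (x j)) =
      ∏ k, f k (x k) * ((if h : i = k then φ (h ▸ x k) else 1) *
        (if h : j = k then ψ (h ▸ x k) else 1)) := by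
    intro x
    rw [Finset.prod_mul_distrib, Finset.prod_mul_distrib, prod_dite_apply, prod_dite_apply]
  rw [Finset.sum_congr rfl fun x _ => h1 x,
    ← Fintype.prod_sum (fun k a => f k a * ((if h : i = k then φ (h ▸ a) else 1) *
        (if h : j = k then ψ (h ▸ a) else 1))),
    Fintype.prod_eq_mul i j hij]
  · simp [hij, hij.symm]
  · intro k hk
    simp [hk.1.symm, hk.2.symm, hf]

/-- Expectation of a function of two coordinates under a product weight. -/
theorem sum_prod_mul_apply₂ (f : ∀ i, α i → ℝ) (hf : ∀ i, ∑ a, f i a = 1) {i j : ι}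
    (hij : i ≠ j) (F : α i → α j → ℝ) :
    ∑ x : ∀ i, α i, (∏ k, f k (x k)) * F (x i) (x j) =
      ∑ a, ∑ b, f i a * f j b * F a b := by
  classical
  have h1 : ∀ x : ∀ i, α i, (∏ k, f k (x k)) * F (x i) (x j) =
      ∑ b, (∏ k, f k (x k)) * (F (x i) b * (if x j = b then 1 else 0)) := by
    intro x
    rw [Finset.sum_eq_single (x j) (fun b _ hb => by simp [hb.symm]) (fun h => by simp at h)]
    simp
  rw [Finset.sum_congr rfl fun x _ => h1 x, Finset.sum_comm]
  have h2 : ∀ b : α j, ∑ x : ∀ i, α i,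
      (∏ k, f k (x k)) * (F (x i) b * (if x j = b then 1 else 0)) =
      ∑ a, f i a * f j b * F a b := by
    intro b
    rw [sum_prod_mul_apply_mul_apply f hf hij (fun a => F a b) (fun c => if c = b then 1 else 0)]
    simp only [mul_ite, mul_one, mul_zero, Finset.sum_ite_eq', Finset.mem_univ, if_true]
    rw [Finset.sum_mul]
    exact Finset.sum_congr rfl fun a _ => by ring
  rw [Finset.sum_congr rfl fun b _ => h2 b, Finset.sum_comm]

end ProductSums

/-! ### Chernoff bound and the channel law. -/

/-- Exponential tail bound for sums of independent copies of a bounded variable with negative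
mean. -/
theorem exists_tail_bound {X : Type*} [Fintype X] (μ ψ : X → ℝ) (hμ : ∀ x, 0 ≤ μ x)
    (h1 : ∑ x, μ x = 1) (hψ : ∑ x, μ x * ψ x < 0) :
    ∃ ρ : ℝ, 0 ≤ ρ ∧ ρ < 1 ∧ ∀ (n : ℕ) (B : Finset (Fin n)),
      ∑ x : Fin n → X, (if 0 ≤ ∑ t ∈ B, ψ (x t) then ∏ t, μ (x t) else 0) ≤ ρ ^ B.card := by
  classical
  obtain ⟨C, hC0, hC⟩ : ∃ C : ℝ, 0 < C ∧ ∀ x, |ψ x| ≤ C := by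
    refine ⟨1 + ∑ x, |ψ x|, by positivity, fun x => ?_⟩
    have := Finset.single_le_sum (f := fun x => |ψ x|) (fun x _ => abs_nonneg _)
      (Finset.mem_univ x)
    linarith
  set δ := -∑ x, μ x * ψ x with hδ
  have hδ0 : 0 < δ := by linarith
  -- `l C ≤ 1` permits `exp y ≤ 1 + y + y ^ 2` at `y = l ψ`; `2 l C ^ 2 ≤ δ` makes the resulting
  -- mean at most `1 - l δ / 2`. The bound `ρ` is the exponential moment at `l`.
  set l := min (1 / C) (δ / (2 * C ^ 2)) with hl
  have hl0 : 0 < l := lt_min (by positivity) (by positivity)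
  have hl1 : l * C ≤ 1 := by
    have := min_le_left (1 / C) (δ / (2 * C ^ 2))
    rw [← hl, le_div_iff₀ hC0] at this
    exact this
  have hl2 : l * (2 * C ^ 2) ≤ δ := by
    have := min_le_right (1 / C) (δ / (2 * C ^ 2))
    rwa [← hl, le_div_iff₀ (by positivity)] at this
  have hexp : ∀ x, Real.exp (l * ψ x) ≤ 1 + l * ψ x + l ^ 2 * C ^ 2 := by
    intro x
    have hb : |l * ψ x| ≤ l * C := by
      rw [abs_mul, abs_of_pos hl0]
      exact mul_le_mul_of_nonneg_left (hC x) hl0.le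
    have h := (abs_le.1 (Real.abs_exp_sub_one_sub_id_le (hb.trans hl1))).2
    have h' : (l * ψ x) ^ 2 ≤ l ^ 2 * C ^ 2 := by
      rw [← mul_pow, ← sq_abs]
      exact pow_le_pow_left₀ (abs_nonneg _) hb 2
    linarith
  refine ⟨∑ x, μ x * Real.exp (l * ψ x),
    Finset.sum_nonneg fun x _ => mul_nonneg (hμ x) (Real.exp_pos _).le, ?_, ?_⟩
  · calc ∑ x, μ x * Real.exp (l * ψ x)
        ≤ ∑ x, μ x * (1 + l * ψ x + l ^ 2 * C ^ 2) :=
          Finset.sum_le_sum fun x _ => mul_le_mul_of_nonneg_left (hexp x) (hμ x)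
      _ = (1 + l ^ 2 * C ^ 2) * ∑ x, μ x + l * ∑ x, μ x * ψ x := by
          rw [Finset.mul_sum, Finset.mul_sum, ← Finset.sum_add_distrib]
          exact Finset.sum_congr rfl fun x _ => by ring
      _ = 1 + l * (l * C ^ 2 - δ) := by rw [h1, hδ]; ring
      _ < 1 := by
          have : l * C ^ 2 - δ < 0 := by linarith
          nlinarith
  · intro n B
    calc ∑ x : Fin n → X, (if 0 ≤ ∑ t ∈ B, ψ (x t) then ∏ t, μ (x t) else 0)
        ≤ ∑ x : Fin n → X, ∏ t, μ (x t) * (if t ∈ B then Real.exp (l * ψ (x t)) else 1) := by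
          refine Finset.sum_le_sum fun x _ => ?_
          have hpos : 0 ≤ ∏ t, μ (x t) := Finset.prod_nonneg fun t _ => hμ _
          rw [Finset.prod_mul_distrib, Finset.prod_ite_mem, Finset.univ_inter, ← Real.exp_sum,
            ← Finset.mul_sum]
          split_ifs with h
          · exact le_mul_of_one_le_right hpos (Real.one_le_exp (mul_nonneg hl0.le h))
          · positivity
      _ = ∏ t : Fin n, ∑ x, μ x * (if t ∈ B then Real.exp (l * ψ x) else 1) :=
          (Fintype.prod_sum (fun (t : Fin n) x =>
            μ x * (if t ∈ B then Real.exp (l * ψ x) else 1))).symm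
      _ = ∏ t : Fin n, (if t ∈ B then ∑ x, μ x * Real.exp (l * ψ x) else 1) := by
          refine Finset.prod_congr rfl fun t _ => ?_
          split_ifs <;> simp [h1]
      _ ≤ _ := by
          rw [Finset.prod_ite_mem, Finset.univ_inter, Finset.prod_const]

variable (N : RelayNetwork)

theorem hopProb_nonneg (m : Fin N.M) (A : N.HopMatrix m) : 0 ≤ N.hopProb m A := by
  refine Finset.prod_nonneg fun j _ => Finset.prod_nonneg fun i _ => ?_
  split_ifs
  · exact N.p_nonneg m j i
  · linarith [N.p_le_one m j i]

theorem sum_hopProb (m : Fin N.M) : ∑ A : N.HopMatrix m, N.hopProb m A = 1 := by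
  have h : ∀ j i, ∑ b : ZMod 2, (if b = 1 then N.p m j i else 1 - N.p m j i) = 1 := by
    intro j i
    rw [show (Finset.univ : Finset (ZMod 2)) = {0, 1} from rfl, Finset.sum_pair zero_ne_one]
    simp
  have h2 : ∀ j, ∑ a : Fin (N.K m) → ZMod 2,
      ∏ i, (if a i = 1 then N.p m j i else 1 - N.p m j i) = 1 := by
    intro j
    rw [← Fintype.prod_sum (fun i (b : ZMod 2) => if b = 1 then N.p m j i else 1 - N.p m j i)]
    simp [h]
  have h3 := Fintype.prod_sum (fun j (a : Fin (N.K m) → ZMod 2) =>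
      ∏ i, (if a i = 1 then N.p m j i else 1 - N.p m j i))
  simp only [h2, Finset.prod_const_one] at h3
  exact h3.symm

/-- Probability of the realization of all hops in one channel use. -/
noncomputable def stepProb (x : (m : Fin N.M) → N.HopMatrix m) : ℝ := ∏ m, N.hopProb m (x m)

theorem stepProb_nonneg (x : (m : Fin N.M) → N.HopMatrix m) : 0 ≤ N.stepProb x :=
  Finset.prod_nonneg fun m _ => N.hopProb_nonneg m _

theorem sum_stepProb : ∑ x, N.stepProb x = 1 := by
  have := Fintype.prod_sum (fun m (a : N.HopMatrix m) => N.hopProb m a)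
  simp only [sum_hopProb, Finset.prod_const_one] at this
  exact this.symm

theorem sum_stepProb_mul (m : Fin N.M) (φ : N.HopMatrix m → ℝ) :
    ∑ x, N.stepProb x * φ (x m) = ∑ a, N.hopProb m a * φ a :=
  sum_prod_mul_apply (fun m a => N.hopProb m a) N.sum_hopProb m φ

theorem channelProb_nonneg {n : ℕ} (H : N.Channel n) : 0 ≤ N.channelProb H :=
  Finset.prod_nonneg fun t _ => N.stepProb_nonneg (H t)

theorem sum_channelProb (n : ℕ) : ∑ H : N.Channel n, N.channelProb H = 1 := by
  have := Fintype.prod_sum (fun (_ : Fin n) x => N.stepProb x)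
  simp only [sum_stepProb, Finset.prod_const_one] at this
  exact this.symm

/-- Exponential tail bound for a function of the channel matrix of one hop. -/
theorem exists_channel_tail_bound (m : Fin N.M) (ψ : N.HopMatrix m → ℝ)
    (hψ : ∑ a, N.hopProb m a * ψ a < 0) :
    ∃ ρ : ℝ, 0 ≤ ρ ∧ ρ < 1 ∧ ∀ (n : ℕ) (B : Finset (Fin n)),
      ∑ H : N.Channel n, (if 0 ≤ ∑ t ∈ B, ψ (H t m) then N.channelProb H else 0) ≤
        ρ ^ B.card :=
  exists_tail_bound N.stepProb (fun x => ψ (x m)) N.stepProb_nonneg N.sum_stepProb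
    (by rwa [N.sum_stepProb_mul m ψ])

end RelayNetwork

/-! ### Converse. -/

namespace RelayNetwork

variable {N : RelayNetwork}

namespace Code

variable {n : ℕ} {L : Fin (N.K 0) → ℕ}

/-- For a fixed channel realization, the symbols received on one hop determine those sent by all
later layers. -/
theorem transmit_congr_of_received (c : N.Code n L) (H : N.Channel n)
    {w w' : (k : Fin (N.K 0)) → Fin (2 ^ L k)} (m₀ : Fin N.M)
    (h : ∀ t, c.received w H m₀ t = c.received w' H m₀ t) (d : ℕ) :
    ∀ (hm : m₀ + 1 + d < N.M) (t : Fin n),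
      c.transmit w H (m₀ + 1 + d) hm t = c.transmit w' H (m₀ + 1 + d) hm t := by
  induction d with
  | zero =>
    intro hm t
    funext k
    simp only [transmit]
    congr 1
    funext s
    exact congrFun (h s) k
  | succ d ih =>
    intro hm t
    funext k
    change c.relay _ _ k t _ _ = c.relay _ _ k t _ _
    congr 1
    funext s
    exact congrArg (fun v => (H s ⟨m₀ + 1 + d, Nat.lt_of_succ_lt hm⟩ *ᵥ v) k)
      (ih (Nat.lt_of_succ_lt hm) s)

theorem decoded_congr_of_received (c : N.Code n L) (H : N.Channel n)
    {w w' : (k : Fin (N.K 0)) → Fin (2 ^ L k)} (m₀ : Fin N.M)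
    (h : ∀ t, c.received w H m₀ t = c.received w' H m₀ t) (k : Fin (N.K 0)) :
    c.decoded w H k = c.decoded w' H k := by
  have key : ∀ t, c.received w H (lastHop N) t = c.received w' H (lastHop N) t := by
    intro t
    rcases Nat.lt_or_ge m₀ (lastHop N) with hlt | hge
    · obtain ⟨d, hd⟩ := Nat.exists_eq_add_of_le (show (m₀ : ℕ) + 1 ≤ lastHop N from hlt)
      have hm : (m₀ : ℕ) + 1 + d < N.M := hd ▸ (lastHop N).isLt
      have he : lastHop N = ⟨(m₀ : ℕ) + 1 + d, hm⟩ := Fin.ext hd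
      rw [he]
      simp only [received]
      rw [transmit_congr_of_received c H m₀ h d hm t]
    · have he : lastHop N = m₀ := by
        apply Fin.ext
        have h1 : ((lastHop N : Fin N.M) : ℕ) = N.M - 1 := rfl
        have := m₀.isLt
        omega
      rw [he]
      exact h t
  simp only [decoded, key]

/-- For a fixed channel realization, the number of message tuples that are decoded correctly is
bounded by the number of sequences that can be received on a given hop. -/
theorem card_decoded_le (c : N.Code n L) (H : N.Channel n) (m₀ : Fin N.M) :
    (Finset.univ.filter fun w => ∀ k, c.decoded w H k = w k).card ≤
      2 ^ ∑ t, (H t m₀).rank := by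
  classical
  have hcard : Fintype.card ((t : Fin n) → LinearMap.range (H t m₀).mulVecLin) =
      2 ^ ∑ t, (H t m₀).rank := by
    rw [Fintype.card_pi, ← Finset.prod_pow_eq_pow_sum]
    refine Finset.prod_congr rfl fun t _ => ?_
    rw [Module.card_eq_pow_finrank (K := ZMod 2), ZMod.card]
    rfl
  rw [← hcard]
  refine Finset.card_le_card_of_injOn
    (fun w t => ⟨c.received w H m₀ t, ⟨c.transmit w H m₀ m₀.isLt t, rfl⟩⟩)
    (fun _ _ => Finset.mem_univ _) ?_
  intro w hw w' hw' heq
  simp only [Finset.coe_filter, Finset.mem_univ, true_and, Set.mem_ofPred_eq] at hw hw'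
  funext k
  rw [← hw k, ← hw' k]
  exact decoded_congr_of_received c H m₀ (fun t => congrArg Subtype.val (congrFun heq t)) k

theorem errorProb_nonneg (c : N.Code n L) (k : Fin (N.K 0)) : 0 ≤ c.errorProb k := by
  refine div_nonneg (Finset.sum_nonneg fun w _ => Finset.sum_nonneg fun H _ => ?_) (by positivity)
  split_ifs
  exacts [N.channelProb_nonneg H, le_rfl]

theorem card_messages (L : Fin (N.K 0) → ℕ) :
    Fintype.card ((k : Fin (N.K 0)) → Fin (2 ^ L k)) = 2 ^ ∑ k, L k := by
  simp [Fintype.card_pi, Finset.prod_pow_eq_pow_sum]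

/-- The probability that some destination errs is large unless the number of messages is at most
about the number of sequences that can be received on hop `m₀`. -/
theorem one_le_sum_errorProb (c : N.Code n L) (m₀ : Fin N.M) (r : ℝ) :
    1 ≤ ∑ k, c.errorProb k +
      ∑ H : N.Channel n, (if 0 ≤ ∑ t : Fin n, (((H t m₀).rank : ℝ) - r) then
        N.channelProb H else 0) +
      (2 : ℝ) ^ (n * r - ∑ k, (L k : ℝ)) := by
  classical
  set C : ℝ := (Fintype.card ((k : Fin (N.K 0)) → Fin (2 ^ L k)) : ℝ) with hC
  have hC2 : C = (2 : ℝ) ^ (∑ k, (L k : ℝ)) := by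
    rw [hC, card_messages, ← Nat.cast_sum, Real.rpow_natCast]
    push_cast
    rfl
  have hC0 : 0 < C := by rw [hC2]; positivity
  have hErr : ∑ k, c.errorProb k =
      (∑ H : N.Channel n, N.channelProb H *
        ∑ w : (k : Fin (N.K 0)) → Fin (2 ^ L k), ∑ k, (if c.decoded w H k ≠ w k then 1 else 0)) /
        C := by
    simp only [errorProb, ← Finset.sum_div]
    congr 1
    rw [Finset.sum_comm]
    simp only [Finset.mul_sum]
    rw [Finset.sum_comm' (s := Finset.univ (α := N.Channel n)) (t := fun _ => Finset.univ)
      (t' := Finset.univ) (s' := fun _ => Finset.univ) (by simp)]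
    refine Finset.sum_congr rfl fun w _ => ?_
    rw [Finset.sum_comm]
    refine Finset.sum_congr rfl fun H _ => Finset.sum_congr rfl fun k _ => ?_
    split_ifs <;> simp
  -- Pointwise in `H`: if the ranks add up to at least `n r`, the second term suffices. Otherwise at
  -- most `2 ^ (n r)` of the `C` message tuples are decoded correctly, and each other tuple
  -- contributes at least one error.
  have hH : ∀ H : N.Channel n, N.channelProb H ≤
      (N.channelProb H * ∑ w : (k : Fin (N.K 0)) → Fin (2 ^ L k),
        ∑ k, (if c.decoded w H k ≠ w k then (1 : ℝ) else 0)) / C +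
      (if 0 ≤ ∑ t : Fin n, (((H t m₀).rank : ℝ) - r) then N.channelProb H else 0) +
      N.channelProb H * (2 : ℝ) ^ (n * r - ∑ k, (L k : ℝ)) := by
    intro H
    have hp := N.channelProb_nonneg H
    have hsum : 0 ≤ ∑ w : (k : Fin (N.K 0)) → Fin (2 ^ L k),
        ∑ k, (if c.decoded w H k ≠ w k then (1 : ℝ) else 0) :=
      Finset.sum_nonneg fun w _ => Finset.sum_nonneg fun k _ => by split_ifs <;> norm_num
    split_ifs with h
    · have : 0 ≤ N.channelProb H * (2 : ℝ) ^ (n * r - ∑ k, (L k : ℝ)) := by positivity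
      have h2 : 0 ≤ (N.channelProb H * ∑ w : (k : Fin (N.K 0)) → Fin (2 ^ L k),
        ∑ k, (if c.decoded w H k ≠ w k then (1 : ℝ) else 0)) / C := by positivity
      linarith
    · have h1 : C ≤ (∑ w : (k : Fin (N.K 0)) → Fin (2 ^ L k),
          ∑ k, (if c.decoded w H k ≠ w k then (1 : ℝ) else 0)) +
          ((Finset.univ.filter fun w => ∀ k, c.decoded w H k = w k).card : ℝ) := by
        rw [hC, ← Finset.card_univ, Finset.card_eq_sum_ones, Finset.card_filter]
        push_cast
        rw [← Finset.sum_add_distrib]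
        refine Finset.sum_le_sum fun w _ => ?_
        split_ifs with hw
        · have : 0 ≤ ∑ k, (if c.decoded w H k ≠ w k then (1 : ℝ) else 0) :=
            Finset.sum_nonneg fun k _ => by split_ifs <;> norm_num
          linarith
        · push Not at hw
          obtain ⟨k, hk⟩ := hw
          have := Finset.single_le_sum
            (f := fun k => (if c.decoded w H k ≠ w k then (1 : ℝ) else 0))
            (fun k _ => by positivity) (Finset.mem_univ k)
          simp only [if_pos hk] at this
          linarith
      have h2 : ((Finset.univ.filter fun w => ∀ k, c.decoded w H k = w k).card : ℝ) ≤
          (2 : ℝ) ^ (n * r) := by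
        refine le_trans (Nat.cast_le.2 (c.card_decoded_le H m₀)) ?_
        push_cast
        rw [← Real.rpow_natCast]
        refine Real.rpow_le_rpow_of_exponent_le (by norm_num) ?_
        push Not at h
        simp only [Finset.sum_sub_distrib, Finset.sum_const, Finset.card_univ, Fintype.card_fin,
          nsmul_eq_mul] at h
        push_cast
        linarith
      have h3 : (1 : ℝ) ≤ (∑ w : (k : Fin (N.K 0)) → Fin (2 ^ L k),
          ∑ k, (if c.decoded w H k ≠ w k then (1 : ℝ) else 0)) / C +
          (2 : ℝ) ^ (n * r - ∑ k, (L k : ℝ)) := by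
        rw [Real.rpow_sub (by norm_num), ← hC2, ← add_div, le_div_iff₀ hC0]
        linarith
      calc N.channelProb H = N.channelProb H * 1 := (mul_one _).symm
        _ ≤ _ := mul_le_mul_of_nonneg_left h3 hp
        _ = _ := by ring
  calc (1 : ℝ) = ∑ H : N.Channel n, N.channelProb H := (N.sum_channelProb n).symm
    _ ≤ _ := Finset.sum_le_sum fun H _ => hH H
    _ = _ := by
      rw [Finset.sum_add_distrib, Finset.sum_add_distrib, hErr, ← Finset.sum_div,
        ← Finset.sum_mul, N.sum_channelProb, one_mul]

end Code

/-- The expected rank of every hop bounds the achievable sum rates. -/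
theorem Achievable.sum_le_avgRank {R : Fin (N.K 0) → ℝ} (hR : N.Achievable R) (m₀ : Fin N.M) :
    ∑ k, R k ≤ N.avgRank m₀ := by
  obtain ⟨hR0, c, hc⟩ := hR
  by_contra! hlt
  set δ := (∑ k, R k - N.avgRank m₀) / 2 with hδ
  have hδ0 : 0 < δ := by rw [hδ]; linarith
  obtain ⟨ρ, hρ0, hρ1, hρ⟩ := N.exists_channel_tail_bound m₀
    (fun a => (a.rank : ℝ) - (N.avgRank m₀ + δ)) (by
      simp only [mul_sub, Finset.sum_sub_distrib, ← Finset.sum_mul, N.sum_hopProb]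
      change N.avgRank m₀ - _ < 0
      linarith)
  -- The threshold lies halfway between `avgRank` and the sum rate, leaving `δ` on either side; the
  -- factor `2 ^ K 0` pays for rounding each message length down by less than one bit.
  have hle : ∀ n : ℕ, 1 ≤ ∑ k, (c n).errorProb k + ρ ^ n +
      (2 : ℝ) ^ (N.K 0 : ℝ) * ((2 : ℝ) ^ (-δ)) ^ n := by
    intro n
    refine ((c n).one_le_sum_errorProb m₀ (N.avgRank m₀ + δ)).trans ?_
    have h1 := hρ n Finset.univ
    rw [Finset.card_univ, Fintype.card_fin] at h1
    have h2 : (2 : ℝ) ^ (n * (N.avgRank m₀ + δ) - ∑ k, ((⌊(n : ℝ) * R k⌋₊ : ℕ) : ℝ)) ≤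
        (2 : ℝ) ^ (N.K 0 : ℝ) * ((2 : ℝ) ^ (-δ)) ^ n := by
      rw [← Real.rpow_natCast, ← Real.rpow_mul (by norm_num), ← Real.rpow_add (by norm_num)]
      refine Real.rpow_le_rpow_of_exponent_le (by norm_num) ?_
      have h3 : ∑ k, ((n : ℝ) * R k - 1) ≤ ∑ k, ((⌊(n : ℝ) * R k⌋₊ : ℕ) : ℝ) :=
        Finset.sum_le_sum fun k _ => (Nat.sub_one_lt_floor _).le
      rw [Finset.sum_sub_distrib, ← Finset.mul_sum] at h3
      simp only [Finset.sum_const, Finset.card_univ, Fintype.card_fin, nsmul_eq_mul,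
        mul_one] at h3
      have h4 : ∑ k, R k = N.avgRank m₀ + 2 * δ := by rw [hδ]; ring
      rw [h4] at h3
      linarith
    exact add_le_add (add_le_add le_rfl h1) h2
  have hlim : Filter.Tendsto (fun n : ℕ => ∑ k, (c n).errorProb k + ρ ^ n +
      (2 : ℝ) ^ (N.K 0 : ℝ) * ((2 : ℝ) ^ (-δ)) ^ n) Filter.atTop
      (nhds (0 + 0 + 2 ^ (N.K 0 : ℝ) * 0)) := by
    refine Filter.Tendsto.add (Filter.Tendsto.add ?_ ?_) (Filter.Tendsto.const_mul _ ?_)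
    · have := tendsto_finsetSum (Finset.univ : Finset (Fin (N.K 0))) (fun k _ => hc k)
      simpa using this
    · exact tendsto_pow_atTop_nhds_zero_of_lt_one hρ0 hρ1
    · refine tendsto_pow_atTop_nhds_zero_of_lt_one (by positivity) ?_
      exact Real.rpow_lt_one_of_one_lt_of_neg (by norm_num) (by linarith)
  have := ge_of_tendsto' hlim hle
  norm_num at this

end RelayNetwork

/-! ### Block-Markov forwarding of packets. -/

namespace RelayNetwork

section Ranking

/-- The elements of a finite type can be numbered consecutively within each fibre of a map. -/
theorem exists_fiber_ranking {P α : Type*} [Fintype P] [DecidableEq α] (f : P → α) :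
    ∃ rk : P → ℕ, (∀ p p', f p = f p' → rk p = rk p' → p = p') ∧
      ∀ p, rk p < (Finset.univ.filter fun p' => f p' = f p).card := by
  classical
  let e := Fintype.equivFin P
  have hmono : ∀ p p', f p = f p' → e p < e p' →
      (Finset.univ.filter fun x => f x = f p ∧ e x < e p).card <
        (Finset.univ.filter fun x => f x = f p' ∧ e x < e p').card := by
    intro p p' hf hlt
    refine Finset.card_lt_card ⟨fun x hx => ?_, fun h => ?_⟩
    · simp only [Finset.mem_filter, Finset.mem_univ, true_and] at hx ⊢
      exact ⟨hx.1.trans hf, hx.2.trans hlt⟩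
    · have := h (Finset.mem_filter.2 ⟨Finset.mem_univ p, hf, hlt⟩)
      exact lt_irrefl _ (Finset.mem_filter.1 this).2.2
  refine ⟨fun p => (Finset.univ.filter fun x => f x = f p ∧ e x < e p).card, ?_, ?_⟩
  · intro p p' hf hrk
    rcases lt_trichotomy (e p) (e p') with h | h | h
    · exact absurd hrk (hmono p p' hf h).ne
    · exact e.injective h
    · exact absurd hrk (hmono p' p hf.symm h).ne'
  · intro p
    refine Finset.card_lt_card ⟨fun x hx => ?_, fun h => ?_⟩
    · simp only [Finset.mem_filter, Finset.mem_univ, true_and] at hx ⊢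
      exact hx.1
    · have := h (Finset.mem_filter.2 ⟨Finset.mem_univ p, rfl⟩)
      exact lt_irrefl _ (Finset.mem_filter.1 this).2.2

/-- The number of predecessors within `s` is injective on `s` with values below `s.card`, hence
takes every such value. -/
theorem exists_mem_card_filter_lt {α : Type*} [LinearOrder α] (s : Finset α) {j : ℕ}
    (hj : j < s.card) : ∃ t ∈ s, (s.filter fun x => x < t).card = j := by
  have hmono : ∀ x ∈ s, ∀ y, x < y →
      (s.filter fun z => z < x).card < (s.filter fun z => z < y).card := by
    intro x hx y hxy
    refine Finset.card_lt_card ⟨fun z hz => ?_, fun h => ?_⟩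
    · rw [Finset.mem_filter] at hz ⊢
      exact ⟨hz.1, hz.2.trans hxy⟩
    · exact lt_irrefl _ (Finset.mem_filter.1 (h (Finset.mem_filter.2 ⟨hx, hxy⟩))).2
  have hinj : Set.InjOn (fun t => (s.filter fun x => x < t).card) s := by
    intro x hx y hy hxy
    rcases lt_trichotomy x y with h | h | h
    · exact absurd hxy (hmono x hx y h).ne
    · exact h
    · exact absurd hxy (hmono y hy x h).ne'
  have himage : s.image (fun t => (s.filter fun x => x < t).card) = Finset.range s.card := by
    refine Finset.eq_of_subset_of_card_le (fun i hi => ?_) ?_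
    · obtain ⟨t, ht, rfl⟩ := Finset.mem_image.1 hi
      refine Finset.mem_range.2 (Finset.card_lt_card ⟨Finset.filter_subset _ _, fun h => ?_⟩)
      exact lt_irrefl _ (Finset.mem_filter.1 (h ht)).2
    · rw [Finset.card_image_of_injOn hinj, Finset.card_range]
  have := Finset.mem_range.2 hj
  rw [← himage, Finset.mem_image] at this
  exact this

end Ranking

variable {N : RelayNetwork} {n : ℕ}

/-- The vectors sent by the layers when the nodes outside the sets `S` stay silent and those in
`S` forward what they receive through the channel matrices `A`. -/
noncomputable def flow (A : (m : Fin N.M) → N.HopMatrix m) (S : (m : Fin N.M) → Set (Fin (N.K m)))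
    (x : Fin (N.K 0) → ZMod 2) : (m : ℕ) → m < N.M → Fin (N.K m) → ZMod 2
  | 0, hm => (S ⟨0, hm⟩).indicator x
  | m + 1, hm => (S ⟨m + 1, hm⟩).indicator
      (A ⟨m, Nat.lt_of_succ_lt hm⟩ *ᵥ flow A S x m (Nat.lt_of_succ_lt hm))

/-- Every active source is heard without interference by its destination. -/
def IsInterferenceFree (A : (m : Fin N.M) → N.HopMatrix m)
    (S : (m : Fin N.M) → Set (Fin (N.K m))) : Prop :=
  ∀ (x : Fin (N.K 0) → ZMod 2) (k : Fin (N.K 0)), k ∈ S ⟨0, N.M_pos⟩ →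
    (A (Code.lastHop N) *ᵥ flow A S x (Code.lastHop N) (Code.lastHop N).isLt)
      (Fin.cast (Code.K_lastHop N) k) = x k

/-- Node functions of the channel that depend only on the available channel state information
define a code. -/
theorem exists_code {L : Fin (N.K 0) → ℕ}
    (enc : (k : Fin (N.K 0)) → (t : Fin n) → Fin (2 ^ L k) → N.Channel n → ZMod 2)
    (relay : (m : ℕ) → (hm : m + 1 < N.M) → Fin (N.K (m + 1)) → (t : Fin n) →
      ({s : Fin n // s < t} → ZMod 2) → N.Channel n → ZMod 2)
    (dec : (k : Fin (N.K 0)) → (Fin n → ZMod 2) → N.Channel n → Fin (2 ^ L k))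
    (henc : ∀ k t w H H', N.csi H ⟨0, N.M_pos⟩ t = N.csi H' ⟨0, N.M_pos⟩ t →
      enc k t w H = enc k t w H')
    (hrelay : ∀ m hm k t y H H', N.csi H ⟨m + 1, hm⟩ t = N.csi H' ⟨m + 1, hm⟩ t →
      relay m hm k t y H = relay m hm k t y H') :
    ∃ c : N.Code n L,
      (∀ k t w H, c.enc k t w (N.csi H ⟨0, N.M_pos⟩ t) = enc k t w H) ∧
      (∀ m hm k t y H, c.relay m hm k t y (N.csi H ⟨m + 1, hm⟩ t) = relay m hm k t y H) ∧
      c.dec = dec := by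
  -- The hypotheses say that the node functions factor through `csi`; the default `0` is used only
  -- off its range and never matters.
  refine ⟨⟨fun k t w => Function.extend (fun H => N.csi H ⟨0, N.M_pos⟩ t) (enc k t w) 0,
    fun m hm k t y => Function.extend (fun H => N.csi H ⟨m + 1, hm⟩ t) (relay m hm k t y) 0,
    dec⟩, ?_, ?_, rfl⟩
  · intro k t w H
    exact Function.FactorsThrough.extend_apply
      (fun H H' h => henc k t w H H' h) _ H
  · intro m hm k t y H
    exact Function.FactorsThrough.extend_apply
      (fun H H' h => hrelay m hm k t y H H' h) _ H

theorem eq_of_csi_eq {H H' : N.Channel n} {m : Fin N.M} {t : Fin n}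
    (h : N.csi H m t = N.csi H' m t) {l : Fin N.M} (hl : l ≤ m) {s : Fin n} (hs : s ≤ t) :
    H s l = H' s l :=
  congrFun (congrFun h ⟨s, hs⟩) ⟨l, hl⟩

section Scheme

variable {P : Type*} (ℓ : ℕ) (A : P → (m : Fin N.M) → N.HopMatrix m) (rk : Fin N.M → P → ℕ)

/-- At time `t` hop `m` carries the packet `p` of group `g`: time is divided into blocks of length
`ℓ`, group `g` is carried by hop `m` in block `g + m`, and the packets are assigned to the times
of the block according to the channel matrix and to the number of its previous occurrences. -/
def Serves (H : N.Channel n) (m : Fin N.M) (t : Fin n) (g : ℕ) (p : P) : Prop :=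
  (t : ℕ) / ℓ = g + m ∧ H t m = A p m ∧
    (Finset.univ.filter fun s : Fin n => ((s : ℕ) / ℓ = g + m ∧ H s m = A p m) ∧ s < t).card =
      rk m p

variable {ℓ A rk}

/-- Causality of the schedule: it inspects the current matrix of the hop and counts earlier
occurrences only. -/
theorem Serves.of_csi_eq {H H' : N.Channel n} {m : Fin N.M} {t : Fin n}
    (h : N.csi H m t = N.csi H' m t) {l : Fin N.M} (hl : l ≤ m) {s : Fin n} (hs : s ≤ t)
    {g : ℕ} {p : P} (hS : Serves ℓ A rk H l s g p) : Serves ℓ A rk H' l s g p := by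
  refine ⟨hS.1, (eq_of_csi_eq h hl hs).symm.trans hS.2.1, ?_⟩
  rw [← hS.2.2]
  congr 1
  ext x
  simp only [Finset.mem_filter, Finset.mem_univ, true_and]
  refine and_congr_left fun hx => ?_
  rw [eq_of_csi_eq h hl (hx.le.trans hs)]

theorem serves_eq_of_csi_eq {H H' : N.Channel n} {m : Fin N.M} {t : Fin n}
    (h : N.csi H m t = N.csi H' m t) {l : Fin N.M} (hl : l ≤ m) {s : Fin n} (hs : s ≤ t) :
    Serves ℓ A rk H l s = Serves ℓ A rk H' l s := by
  funext g p
  exact propext ⟨Serves.of_csi_eq h hl hs, Serves.of_csi_eq h.symm hl hs⟩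

/-- The block and the hop give the group; packets waiting for the same matrix are told apart by
their ranks. -/
theorem Serves.unique
    (hrk : ∀ m p p', A p m = A p' m → rk m p = rk m p' → p = p')
    {H : N.Channel n} {m : Fin N.M} {t : Fin n} {g g' : ℕ} {p p' : P}
    (h : Serves ℓ A rk H m t g p) (h' : Serves ℓ A rk H m t g' p') : g = g' ∧ p = p' := by
  have hg : g = g' := by
    have := h.1.symm.trans h'.1
    omega
  subst hg
  have hA := h.2.1.symm.trans h'.2.1
  refine ⟨rfl, hrk m p p' hA ?_⟩
  rw [← h.2.2, ← h'.2.2, hA]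

theorem exists_serves [Fintype P] {H : N.Channel n} {m : Fin N.M} {g : ℕ} {p : P}
    (hrk : rk m p < (Finset.univ.filter fun p' => A p' m = A p m).card)
    (hH : (Finset.univ.filter fun p' => A p' m = A p m).card ≤
      (Finset.univ.filter fun t : Fin n => (t : ℕ) / ℓ = g + m ∧ H t m = A p m).card) :
    ∃ t, Serves ℓ A rk H m t g p := by
  obtain ⟨t, ht, hcard⟩ := exists_mem_card_filter_lt _ (hrk.trans_le hH)
  simp only [Finset.mem_filter, Finset.mem_univ, true_and] at ht
  refine ⟨t, ht.1, ht.2, ?_⟩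
  rw [← hcard, Finset.filter_filter]

/-- Block-Markov forwarding of interference-free packets: every message is decoded correctly if
every channel matrix occurs at least as often in each block as it is needed. -/
theorem exists_forwarding_code [Fintype P] {L : Fin (N.K 0) → ℕ} (ℓ G : ℕ)
    (A : P → (m : Fin N.M) → N.HopMatrix m) (S : P → (m : Fin N.M) → Set (Fin (N.K m)))
    (hAS : ∀ p, IsInterferenceFree (A p) (S p))
    (D : (k : Fin (N.K 0)) → Fin (2 ^ L k) → ℕ → P → ZMod 2)
    (hD : ∀ k w w', (∀ g < G, ∀ p, k ∈ S p ⟨0, N.M_pos⟩ → D k w g p = D k w' g p) → w = w') :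
    ∃ c : N.Code n L, ∀ H : N.Channel n,
      (∀ (m : Fin N.M) (g : ℕ) (p : P), g < G →
        (Finset.univ.filter fun p' => A p' m = A p m).card ≤
        (Finset.univ.filter fun t : Fin n => (t : ℕ) / ℓ = g + m ∧ H t m = A p m).card) →
      ∀ w k, c.decoded w H k = w k := by
  classical
  have hex := fun m : Fin N.M => exists_fiber_ranking fun p => A p m
  choose rk hrk hrklt using hex
  -- `Q` is the schedule at the current time. Inactive nodes and idle times send `0`.
  let encF : (k : Fin (N.K 0)) → Fin (2 ^ L k) → (ℕ → P → Prop) → ZMod 2 := fun k w Q =>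
    if h : ∃ gp : ℕ × P, gp.1 < G ∧ Q gp.1 gp.2 then
      if k ∈ S h.choose.2 ⟨0, N.M_pos⟩ then D k w h.choose.1 h.choose.2 else 0
    else 0
  let relayF : (m : Fin N.M) → Fin (N.K m) → (t : Fin n) → ({s : Fin n // s < t} → ZMod 2) →
      (ℕ → P → Prop) → ({s : Fin n // s < t} → ℕ → P → Prop) → ZMod 2 := fun m k t y Q Q' =>
    if h : ∃ gp : ℕ × P, gp.1 < G ∧ Q gp.1 gp.2 then
      if k ∈ S h.choose.2 m then
        if h' : ∃ s, Q' s h.choose.1 h.choose.2 then y h'.choose else 0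
      else 0
    else 0
  obtain ⟨c, henc, hrelay, hdec⟩ := exists_code (N := N) (n := n) (L := L)
    (fun k t w H => encF k w (Serves ℓ A rk H ⟨0, N.M_pos⟩ t))
    (fun m hm k t y H => relayF ⟨m + 1, hm⟩ k t y (Serves ℓ A rk H ⟨m + 1, hm⟩ t)
      (fun s => Serves ℓ A rk H ⟨m, Nat.lt_of_succ_lt hm⟩ s))
    -- The decoder takes any message consistent with the packets received; `hD` will make it unique
    -- once every packet has been served.
    (fun k y H => if h : ∃ w : Fin (2 ^ L k), ∀ g < G, ∀ p, k ∈ S p ⟨0, N.M_pos⟩ → ∀ t,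
      Serves ℓ A rk H (Code.lastHop N) t g p → D k w g p = y t then h.choose else
        ⟨0, by positivity⟩)
    (fun k t w H H' h => by rw [serves_eq_of_csi_eq h le_rfl le_rfl])
    (fun m hm k t y H H' h => by
      have h1 : ∀ s : {s : Fin n // s < t},
          Serves ℓ A rk H ⟨m, Nat.lt_of_succ_lt hm⟩ s =
            Serves ℓ A rk H' ⟨m, Nat.lt_of_succ_lt hm⟩ s := fun s =>
        serves_eq_of_csi_eq h (Fin.mk_le_mk.2 (Nat.le_succ m)) s.2.le
      simp only [serves_eq_of_csi_eq h le_rfl le_rfl, h1])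
  refine ⟨c, fun H hH w k => ?_⟩
  have hserved : ∀ (m : Fin N.M) (g : ℕ) (p : P), g < G → ∃ t, Serves ℓ A rk H m t g p :=
    fun m g p hg => exists_serves (hrklt m p) (hH m g p hg)
  have htrans : ∀ (m : ℕ) (hm : m < N.M) (t : Fin n) (g : ℕ) (p : P), g < G →
      Serves ℓ A rk H ⟨m, hm⟩ t g p →
      c.transmit w H m hm t = flow (A p) (S p) (fun k => D k (w k) g p) m hm := by
    intro m
    induction m with
    | zero =>
      intro hm t g p hg hS
      funext k
      rw [Code.transmit, flow]
      beta_reduce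
      rw [henc]
      have h : ∃ gp : ℕ × P, gp.1 < G ∧ Serves ℓ A rk H ⟨0, N.M_pos⟩ t gp.1 gp.2 :=
        ⟨(g, p), hg, hS⟩
      obtain ⟨h1, h2⟩ := Serves.unique hrk h.choose_spec.2 hS
      simp only [encF]
      rw [dif_pos h, h1, h2]
      by_cases hk : k ∈ S p ⟨0, N.M_pos⟩
      · rw [Set.indicator_of_mem hk, if_pos hk]
      · rw [Set.indicator_of_notMem hk, if_neg hk]
    | succ m ih =>
      intro hm t g p hg hS
      funext k
      rw [Code.transmit, flow]
      beta_reduce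
      rw [hrelay]
      have h : ∃ gp : ℕ × P, gp.1 < G ∧ Serves ℓ A rk H ⟨m + 1, hm⟩ t gp.1 gp.2 :=
        ⟨(g, p), hg, hS⟩
      obtain ⟨h1, h2⟩ := Serves.unique hrk h.choose_spec.2 hS
      simp only [relayF]
      rw [dif_pos h, h1, h2]
      by_cases hk : k ∈ S p ⟨m + 1, hm⟩
      · rw [Set.indicator_of_mem hk, if_pos hk]
        obtain ⟨s, hs⟩ := hserved ⟨m, Nat.lt_of_succ_lt hm⟩ g p hg
        -- Hop `m` carries group `g` one block before hop `m + 1` does, so the relay has already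
        -- received its symbol.
        have hst : s < t := by
          by_contra! hle
          have h3 : (t : ℕ) / ℓ ≤ (s : ℕ) / ℓ := Nat.div_le_div_right hle
          have h4 := hS.1
          have h5 := hs.1
          simp only at h4 h5
          omega
        have h' : ∃ s : {s : Fin n // s < t},
            Serves ℓ A rk H ⟨m, Nat.lt_of_succ_lt hm⟩ s g p := ⟨⟨s, hst⟩, hs⟩
        rw [dif_pos h', ih (Nat.lt_of_succ_lt hm) _ g p hg h'.choose_spec, h'.choose_spec.2.1]
      · rw [Set.indicator_of_notMem hk, if_neg hk]
  have hrec : ∀ g < G, ∀ p, k ∈ S p ⟨0, N.M_pos⟩ → ∀ t,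
      Serves ℓ A rk H (Code.lastHop N) t g p →
      D k (w k) g p = c.received w H (Code.lastHop N) t (Fin.cast (Code.K_lastHop N) k) := by
    intro g hg p hk t hS
    rw [Code.received, htrans _ (Code.lastHop N).isLt t g p hg hS, hS.2.1, hAS p _ k hk]
  rw [Code.decoded, hdec]
  have h : ∃ v : Fin (2 ^ L k), ∀ g < G, ∀ p, k ∈ S p ⟨0, N.M_pos⟩ → ∀ t,
      Serves ℓ A rk H (Code.lastHop N) t g p →
      D k v g p = c.received w H (Code.lastHop N) t (Fin.cast (Code.K_lastHop N) k) :=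
    ⟨w k, hrec⟩
  simp only
  rw [dif_pos h]
  refine hD k _ _ fun g hg p hk => ?_
  obtain ⟨t, ht⟩ := hserved (Code.lastHop N) g p hg
  rw [h.choose_spec g hg p hk t ht, hrec g hg p hk t ht]

end Scheme

end RelayNetwork

/-! ### From weighted packet types to achievable rates. -/

namespace RelayNetwork

theorem card_filter_div_eq {n ℓ b : ℕ} (hℓ : 0 < ℓ) (hb : (b + 1) * ℓ ≤ n) :
    (Finset.univ.filter fun t : Fin n => (t : ℕ) / ℓ = b).card = ℓ := by
  have h : (Finset.univ.filter fun t : Fin n => (t : ℕ) / ℓ = b).card =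
      (Finset.Ico (b * ℓ) ((b + 1) * ℓ)).card := by
    refine Finset.card_bij (fun t _ => (t : ℕ)) ?_ (fun _ _ _ _ h => Fin.ext h) ?_
    · intro t ht
      simp only [Finset.mem_filter, Finset.mem_univ, true_and] at ht
      rw [Finset.mem_Ico, ← Nat.le_div_iff_mul_le hℓ, ← Nat.div_lt_iff_lt_mul hℓ]
      omega
    · intro i hi
      rw [Finset.mem_Ico] at hi
      refine ⟨⟨i, hi.2.trans_le hb⟩, ?_, rfl⟩
      rw [← Nat.le_div_iff_mul_le hℓ, ← Nat.div_lt_iff_lt_mul hℓ] at hi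
      simp only [Finset.mem_filter, Finset.mem_univ, true_and]
      omega
  rw [h, Nat.card_Ico, add_mul, one_mul, Nat.add_sub_cancel_left]

variable {N : RelayNetwork} {n : ℕ}

theorem Code.errorProb_le {L : Fin (N.K 0) → ℕ} (c : N.Code n L) (Good : N.Channel n → Prop)
    [DecidablePred Good]
    (hc : ∀ H, Good H → ∀ w k, c.decoded w H k = w k) (k : Fin (N.K 0)) :
    c.errorProb k ≤ ∑ H : N.Channel n, if Good H then 0 else N.channelProb H := by
  have hpos : (0 : ℝ) < Fintype.card ((k : Fin (N.K 0)) → Fin (2 ^ L k)) := by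
    rw [Code.card_messages]
    positivity
  rw [Code.errorProb, div_le_iff₀ hpos, mul_comm, ← nsmul_eq_mul, ← Finset.card_univ,
    ← Finset.sum_const]
  refine Finset.sum_le_sum fun w _ => Finset.sum_le_sum fun H _ => ?_
  have := N.channelProb_nonneg H
  by_cases hG : Good H
  · simp [hG, hc H hG w k]
  · rw [if_neg hG]
    split_ifs <;> simp [this]

theorem nonempty_code (L : Fin (N.K 0) → ℕ) : Nonempty (N.Code n L) :=
  ⟨⟨fun _ _ _ _ => 0, fun _ _ _ _ _ _ => 0, fun _ _ _ => ⟨0, by positivity⟩⟩⟩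

variable {T : Type*} [Fintype T] {A : T → (m : Fin N.M) → N.HopMatrix m}
  {S : T → (m : Fin N.M) → Set (Fin (N.K m))}

open scoped Classical in
/-- A forwarding code that sends `G` groups of `cnt τ` packets of type `τ`. -/
theorem exists_group_code {L : Fin (N.K 0) → ℕ} (ℓ G : ℕ) (cnt : T → ℕ)
    (hAS : ∀ τ, cnt τ ≠ 0 → IsInterferenceFree (A τ) (S τ))
    (hL : ∀ k, L k ≤ G * ∑ τ, if k ∈ S τ ⟨0, N.M_pos⟩ then cnt τ else 0) :
    ∃ c : N.Code n L, ∀ H : N.Channel n,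
      (∀ (m : Fin N.M) (g : ℕ) (τ : T), g < G → cnt τ ≠ 0 →
        (∑ τ', if A τ' m = A τ m then cnt τ' else 0) ≤
        (Finset.univ.filter fun t : Fin n => (t : ℕ) / ℓ = g + m ∧ H t m = A τ m).card) →
      ∀ w k, c.decoded w H k = w k := by
  have hne : ∀ p : Σ τ, Fin (cnt τ), cnt p.1 ≠ 0 := fun p => p.2.pos.ne'
  -- The message of source `k` is written injectively as an array with one bit for each group and
  -- each packet in which `k` is active; `hL` says that there is room.
  have hf : ∀ k, Nonempty (Fin (2 ^ L k) ↪
      (Fin G × (Σ τ : {τ // k ∈ S τ ⟨0, N.M_pos⟩}, Fin (cnt τ)) → ZMod 2)) := by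
    intro k
    refine Function.Embedding.nonempty_of_card_le ?_
    rw [Fintype.card_fin, Fintype.card_fun, ZMod.card, Fintype.card_prod, Fintype.card_fin,
      Fintype.card_sigma]
    refine Nat.pow_le_pow_right (by norm_num) ((hL k).trans (le_of_eq ?_))
    congr 1
    simp only [Fintype.card_fin]
    rw [← Finset.sum_filter, Finset.sum_subtype (Finset.univ.filter
      fun τ => k ∈ S τ ⟨0, N.M_pos⟩) (p := fun τ => k ∈ S τ ⟨0, N.M_pos⟩) (by simp)]
  have f := fun k => (hf k).some
  obtain ⟨c, hc⟩ := exists_forwarding_code (N := N) (n := n) (L := L) ℓ G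
    (fun p : Σ τ, Fin (cnt τ) => A p.1) (fun p => S p.1) (fun p => hAS p.1 (hne p))
    (fun k w g p => if h : g < G ∧ k ∈ S p.1 ⟨0, N.M_pos⟩ then
      f k w (⟨g, h.1⟩, ⟨⟨p.1, h.2⟩, p.2⟩) else 0) (by
      intro k w w' h
      refine (f k).injective (funext fun x => ?_)
      obtain ⟨g, ⟨τ, hτ⟩, i⟩ := x
      have := h g g.isLt ⟨τ, i⟩ hτ
      rwa [dif_pos ⟨g.isLt, hτ⟩, dif_pos ⟨g.isLt, hτ⟩] at this)
  refine ⟨c, fun H hH w k => hc H (fun m g p hg => ?_) w k⟩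
  refine le_trans (le_of_eq ?_) (hH m g p.1 hg (hne p))
  rw [Finset.card_filter, Fintype.sum_sigma]
  refine Finset.sum_congr rfl fun τ _ => ?_
  simp only
  split_ifs <;> simp

open scoped Classical in
/-- Interference-free packet types whose use of every hop matches the channel statistics can be
served at full rate. -/
theorem achievable_of_packet_types (q : T → ℝ) (hq : ∀ τ, 0 ≤ q τ)
    (hAS : ∀ τ, q τ ≠ 0 → IsInterferenceFree (A τ) (S τ))
    (hmarg : ∀ m a, (∑ τ, if A τ m = a then q τ else 0) ≤ N.hopProb m a)
    {θ : ℝ} (hθ0 : 0 ≤ θ) (hθ1 : θ < 1) :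
    N.Achievable fun k => θ * ∑ τ, if k ∈ S τ ⟨0, N.M_pos⟩ then q τ else 0 := by
  set Q : Fin (N.K 0) → ℝ := fun k => ∑ τ, if k ∈ S τ ⟨0, N.M_pos⟩ then q τ else 0 with hQ
  have hQ0 : ∀ k, 0 ≤ Q k := fun k => Finset.sum_nonneg fun τ _ => by
    split_ifs
    exacts [hq τ, le_rfl]
  refine ⟨fun k => mul_nonneg hθ0 (hQ0 k), ?_⟩
  -- Each block is loaded to the fraction `η < 1` of the expected occurrences, so shortages are
  -- exponentially unlikely. The margin `η > θ` pays for rounding and for the blocks lost in the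
  -- pipeline.
  set η : ℝ := (1 + θ) / 2 with hη
  have hη0 : 0 < η := by rw [hη]; linarith
  have hη1 : η < 1 := by rw [hη]; linarith
  have hθη : θ < η := by rw [hη]; linarith
  obtain ⟨G, hG⟩ := exists_nat_gt (θ * N.M / (η - θ))
  rw [div_lt_iff₀ (by linarith)] at hG
  -- Group `g < G` occupies block `g + m` at hop `m < M`, so `G + M` blocks suffice; `G` is large
  -- enough for `θ B < η G`.
  set B : ℕ := G + N.M with hB
  have hB0 : 0 < B := by have := N.M_pos; omega
  have hBR : (0 : ℝ) < B := Nat.cast_pos.2 hB0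
  have hGB : 0 < η * G - θ * B := by rw [hB]; push_cast; linarith
  have htail : ∀ (m : Fin N.M) (a : N.HopMatrix m), ∃ ρ : ℝ, 0 ≤ ρ ∧ ρ < 1 ∧
      (0 < N.hopProb m a → ∀ (n : ℕ) (I : Finset (Fin n)),
        ∑ H : N.Channel n, (if 0 ≤ ∑ t ∈ I, (η * N.hopProb m a - if H t m = a then 1 else 0) then
          N.channelProb H else 0) ≤ ρ ^ I.card) := by
    intro m a
    by_cases ha : 0 < N.hopProb m a
    · obtain ⟨ρ, h0, h1, h⟩ := N.exists_channel_tail_bound m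
        (fun x => η * N.hopProb m a - if x = a then 1 else 0) (by
          simp only [mul_sub, Finset.sum_sub_distrib, ← Finset.sum_mul, N.sum_hopProb]
          simp only [mul_ite, mul_one, mul_zero, Finset.sum_ite_eq', Finset.mem_univ, if_true,
            one_mul]
          nlinarith)
      exact ⟨ρ, h0, h1, fun _ => h⟩
    · exact ⟨0, le_rfl, zero_lt_one, fun h => absurd h ha⟩
  choose ρ hρ0 hρ1 hρ using htail
  have hrate : ∃ n₀ : ℕ, ∀ n ≥ n₀, ∀ k, ⌊(n : ℝ) * (θ * Q k)⌋₊ ≤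
      G * ∑ τ, if k ∈ S τ ⟨0, N.M_pos⟩ then ⌊η * (n / B : ℕ) * q τ⌋₊ else 0 := by
    have hk : ∀ k, ∃ n₀ : ℕ, ∀ n ≥ n₀, ⌊(n : ℝ) * (θ * Q k)⌋₊ ≤
      G * ∑ τ, if k ∈ S τ ⟨0, N.M_pos⟩ then ⌊η * (n / B : ℕ) * q τ⌋₊ else 0 := by
      intro k
      rcases (hQ0 k).eq_or_lt with h0 | hpos
      · exact ⟨0, fun n _ => by simp [← h0]⟩
      -- Rounding `n / B` and the packet counts costs at most `G (η Q k + card T)` bits, against a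
      -- surplus of `n Q k (η G - θ B) / B`.
      obtain ⟨n₀, hn₀⟩ := exists_nat_gt
        ((G * (η * Q k + Fintype.card T)) * B / (Q k * (η * G - θ * B)))
      refine ⟨n₀, fun n hn => Nat.floor_le_of_le ?_⟩
      have hn' : (G * (η * Q k + Fintype.card T)) * B < n * (Q k * (η * G - θ * B)) := by
        rw [← div_lt_iff₀ (by positivity)]
        exact hn₀.trans_le (Nat.cast_le.2 hn)
      have hdiv : (n : ℝ) / B - 1 ≤ (n / B : ℕ) := by
        have := (Nat.lt_floor_add_one ((n : ℝ) / B))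
        rw [Nat.floor_div_eq_div] at this
        linarith
      have hsum : η * (n / B : ℕ) * Q k - Fintype.card T ≤
          ∑ τ, if k ∈ S τ ⟨0, N.M_pos⟩ then ((⌊η * (n / B : ℕ) * q τ⌋₊ : ℕ) : ℝ) else 0 := by
        rw [hQ, Finset.mul_sum, ← Finset.card_univ, Finset.card_eq_sum_ones, Nat.cast_sum,
          ← Finset.sum_sub_distrib]
        refine Finset.sum_le_sum fun τ _ => ?_
        split_ifs
        · exact_mod_cast (Nat.sub_one_lt_floor _).le
        · simp
      have hcast : ((G * ∑ τ, if k ∈ S τ ⟨0, N.M_pos⟩ then ⌊η * (n / B : ℕ) * q τ⌋₊ else 0 : ℕ) :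
          ℝ) = G * ∑ τ, if k ∈ S τ ⟨0, N.M_pos⟩ then ((⌊η * (n / B : ℕ) * q τ⌋₊ : ℕ) : ℝ)
            else 0 := by
        push_cast
        rfl
      rw [hcast]
      have hG0 : (0 : ℝ) ≤ G := Nat.cast_nonneg _
      calc (n : ℝ) * (θ * Q k) ≤ G * (η * ((n : ℝ) / B - 1) * Q k - Fintype.card T) := by
            have h1 : (G * (η * Q k + Fintype.card T)) < n * (Q k * (η * G - θ * B)) / B := by
              rwa [lt_div_iff₀ hBR]
            have h2 : n * (Q k * (η * G - θ * B)) / B =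
              G * (η * ((n : ℝ) / B) * Q k) - n * (θ * Q k) := by field_simp
            linarith
        _ ≤ G * (η * (n / B : ℕ) * Q k - Fintype.card T) := by gcongr
        _ ≤ _ := mul_le_mul_of_nonneg_left hsum hG0
    choose n₀ hn₀ using hk
    exact ⟨∑ k, n₀ k, fun n hn k => hn₀ k n
      ((Finset.single_le_sum (fun _ _ => Nat.zero_le _) (Finset.mem_univ k)).trans hn)⟩
  obtain ⟨n₀, hn₀⟩ := hrate
  have hcode : ∀ n ≥ max n₀ B, ∃ c : N.Code n fun k => ⌊(n : ℝ) * (θ * Q k)⌋₊,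
      ∀ k, c.errorProb k ≤ ∑ _b : Fin B, ∑ m, ∑ a, ρ m a ^ (n / B) := by
    intro n hn
    have hℓ0 : 0 < n / B := Nat.div_pos ((le_max_right _ _).trans hn) hB0
    obtain ⟨c, hc⟩ := exists_group_code (N := N) (n := n) (A := A) (S := S) (n / B) G
      (fun τ => ⌊η * (n / B : ℕ) * q τ⌋₊)
      (fun τ hτ => hAS τ fun h0 => hτ (by simp [h0])) (hn₀ n ((le_max_left _ _).trans hn))
    refine ⟨c, fun k => ?_⟩
    refine (c.errorProb_le (fun H => ∀ (b : Fin B) (m : Fin N.M) (a : N.HopMatrix m),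
      0 < N.hopProb m a → η * (n / B : ℕ) * N.hopProb m a ≤
        ((Finset.univ.filter fun t : Fin n => (t : ℕ) / (n / B) = b ∧ H t m = a).card : ℝ))
      (fun H hH => hc H fun m g τ hg hτ => ?_) k).trans ?_
    · have hqτ : 0 < q τ := by
        refine (hq τ).lt_of_ne fun h0 => hτ ?_
        simp [← h0]
      have hpos : 0 < N.hopProb m (A τ m) := by
        refine hqτ.trans_le (le_trans ?_ (hmarg m (A τ m)))
        have := Finset.single_le_sum (f := fun τ' => if A τ' m = A τ m then q τ' else 0)
          (fun τ' _ => by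
            split_ifs
            exacts [hq τ', le_rfl]) (Finset.mem_univ τ)
        simpa using this
      have hgm : g + m < B := by have := m.isLt; omega
      have h1 := hH ⟨g + m, hgm⟩ m (A τ m) hpos
      have h2 : ((∑ τ', if A τ' m = A τ m then ⌊η * (n / B : ℕ) * q τ'⌋₊ else 0 : ℕ) : ℝ) ≤
          η * (n / B : ℕ) * N.hopProb m (A τ m) := by
        refine le_trans ?_ (mul_le_mul_of_nonneg_left (hmarg m (A τ m)) (by positivity))
        rw [Nat.cast_sum, Finset.mul_sum]
        refine Finset.sum_le_sum fun τ' _ => ?_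
        split_ifs
        · exact Nat.floor_le (mul_nonneg (by positivity) (hq τ'))
        · simp
      exact_mod_cast h2.trans h1
    -- Union bound over the blocks, the hops and the matrices of positive probability.
    · have hbad : ∀ H : N.Channel n, (if ∀ (b : Fin B) (m : Fin N.M) (a : N.HopMatrix m),
          0 < N.hopProb m a → η * (n / B : ℕ) * N.hopProb m a ≤
          ((Finset.univ.filter fun t : Fin n => (t : ℕ) / (n / B) = b ∧ H t m = a).card : ℝ)
          then 0 else N.channelProb H) ≤
          ∑ b : Fin B, ∑ m, ∑ a, if 0 < N.hopProb m a then
            (if 0 ≤ ∑ t ∈ Finset.univ.filter fun t : Fin n => (t : ℕ) / (n / B) = b,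
              (η * N.hopProb m a - if H t m = a then 1 else 0) then N.channelProb H else 0)
            else 0 := by
        intro H
        have hp := N.channelProb_nonneg H
        have hnn : ∀ (b : Fin B) (m : Fin N.M) (a : N.HopMatrix m),
            0 ≤ if 0 < N.hopProb m a then
            (if 0 ≤ ∑ t ∈ Finset.univ.filter fun t : Fin n => (t : ℕ) / (n / B) = b,
              (η * N.hopProb m a - if H t m = a then 1 else 0) then N.channelProb H else 0)
            else 0 := by
          intro b m a
          split_ifs <;> simp [hp]
        split_ifs with h
        · exact Finset.sum_nonneg fun b _ => Finset.sum_nonneg fun m _ =>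
            Finset.sum_nonneg fun a _ => hnn b m a
        · push Not at h
          obtain ⟨b, m, a, ha, hlt⟩ := h
          have hblock : (Finset.univ.filter fun t : Fin n => (t : ℕ) / (n / B) = b).card =
              n / B := by
            refine card_filter_div_eq hℓ0 ?_
            calc ((b : ℕ) + 1) * (n / B) ≤ B * (n / B) := Nat.mul_le_mul_right _ b.isLt
              _ ≤ n := Nat.mul_div_le n B
          have hge : 0 ≤ ∑ t ∈ Finset.univ.filter fun t : Fin n => (t : ℕ) / (n / B) = b,
              (η * N.hopProb m a - if H t m = a then 1 else 0) := by
            rw [Finset.sum_sub_distrib, Finset.sum_const, hblock, nsmul_eq_mul, Finset.sum_boole,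
              Finset.filter_filter]
            linarith
          refine le_trans (le_of_eq ?_) ((Finset.single_le_sum (f := fun a => _)
            (fun a _ => hnn b m a) (Finset.mem_univ a)).trans
            ((Finset.single_le_sum (f := fun m => ∑ a, _)
              (fun m _ => Finset.sum_nonneg fun a _ => hnn b m a) (Finset.mem_univ m)).trans
            (Finset.single_le_sum (f := fun b => ∑ m, ∑ a, _)
              (fun b _ => Finset.sum_nonneg fun m _ => Finset.sum_nonneg fun a _ => hnn b m a)
              (Finset.mem_univ b))))
          rw [if_pos ha, if_pos hge]
      refine (Finset.sum_le_sum fun H _ => hbad H).trans ?_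
      rw [Finset.sum_comm]
      refine Finset.sum_le_sum fun b _ => ?_
      rw [Finset.sum_comm]
      refine Finset.sum_le_sum fun m _ => ?_
      rw [Finset.sum_comm]
      refine Finset.sum_le_sum fun a _ => ?_
      by_cases ha : 0 < N.hopProb m a
      · simp only [if_pos ha]
        refine (hρ m a ha n _).trans (le_of_eq ?_)
        congr 1
        refine card_filter_div_eq hℓ0 ?_
        calc ((b : ℕ) + 1) * (n / B) ≤ B * (n / B) := Nat.mul_le_mul_right _ b.isLt
          _ ≤ n := Nat.mul_div_le n B
      · simp only [if_neg ha, Finset.sum_const_zero]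
        exact pow_nonneg (hρ0 m a) _
  refine ⟨fun n => if h : n ≥ max n₀ B then (hcode n h).choose else (nonempty_code _).some,
    fun k => ?_⟩
  have hlim : Filter.Tendsto (fun n : ℕ => ∑ _b : Fin B, ∑ m, ∑ a, ρ m a ^ (n / B))
      Filter.atTop (nhds 0) := by
    have hd : Filter.Tendsto (fun n : ℕ => n / B) Filter.atTop Filter.atTop :=
      Nat.tendsto_div_const_atTop hB0.ne'
    have h := tendsto_finsetSum (Finset.univ : Finset (Fin B)) fun _ _ =>
      tendsto_finsetSum (Finset.univ : Finset (Fin N.M)) fun m _ =>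
        tendsto_finsetSum (Finset.univ : Finset (N.HopMatrix m)) fun a _ =>
          (tendsto_pow_atTop_nhds_zero_of_lt_one (hρ0 m a) (hρ1 m a)).comp hd
    simpa using h
  refine squeeze_zero' (Filter.Eventually.of_forall fun n => Code.errorProb_nonneg _ k) ?_ hlim
  filter_upwards [Filter.eventually_ge_atTop (max n₀ B)] with n hn
  rw [dif_pos hn]
  exact (hcode n hn).choose_spec k

end RelayNetwork

/-! ### Pivots: nonsingular blocks of full rank. -/

namespace RelayNetwork

section Minors

variable {F : Type*} [Field F] {a b r : ℕ}

theorem exists_embedding_linearIndependent {V : Type*} [AddCommGroup V] [Module F V]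
    [FiniteDimensional F V] (v : Fin b → V)
    (hv : Module.finrank F (Submodule.span F (Set.range v)) = r) :
    ∃ e : Fin r ↪ Fin b, LinearIndependent F (v ∘ e) := by
  obtain ⟨κ, f, hf, hspan, hli⟩ := exists_linearIndependent' F v
  have : Finite κ := Finite.of_injective f hf
  have : Fintype κ := Fintype.ofFinite κ
  have hcard : Fintype.card κ = r := by
    rw [← finrank_span_eq_card hli, hspan, hv]
  obtain ⟨g⟩ : Nonempty (Fin r ≃ κ) := ⟨(Fintype.equivFinOfCardEq hcard).symm⟩
  exact ⟨g.toEmbedding.trans ⟨f, hf⟩, hli.comp g g.injective⟩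

/-- Choose `r` independent rows; the matrix they form still has rank `r`, so it has `r` independent
columns. -/
theorem exists_isUnit_submatrix (A : Matrix (Fin b) (Fin a) F) (hA : A.rank = r) :
    ∃ (e' : Fin r ↪ Fin b) (e : Fin r ↪ Fin a), IsUnit (A.submatrix e' e) := by
  obtain ⟨e', he'⟩ := exists_embedding_linearIndependent A.row
    (by rw [← Matrix.rank_eq_finrank_span_row, hA])
  have h1 : (A.submatrix e' id).rank = r := by
    have : LinearIndependent F (A.submatrix e' id).row := he'
    rw [this.rank_matrix, Fintype.card_fin]
  obtain ⟨e, he⟩ := exists_embedding_linearIndependent (A.submatrix e' id).col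
    (by rw [← Matrix.rank_eq_finrank_span_cols, h1])
  exact ⟨e', e, Matrix.linearIndependent_cols_iff_isUnit.1 he⟩

/-- A matrix of rank `r` is determined by `r` rows and `r` columns that meet in a nonsingular
matrix. -/
theorem eq_mul_inv_mul_of_rank_eq (A : Matrix (Fin b) (Fin a) F) (hA : A.rank = r)
    (e' : Fin r ↪ Fin b) (e : Fin r ↪ Fin a) (hu : IsUnit (A.submatrix e' e)) :
    A.submatrix id e * (A.submatrix e' e)⁻¹ * A.submatrix e' id = A := by
  have hle : LinearMap.range (A.submatrix id e).mulVecLin ≤ LinearMap.range A.mulVecLin := by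
    rw [Matrix.range_mulVecLin, Matrix.range_mulVecLin]
    refine Submodule.span_mono ?_
    rintro _ ⟨i, rfl⟩
    exact ⟨e i, rfl⟩
  have hrank : A.rank ≤ (A.submatrix id e).rank := by
    have h1 := ((A.submatrix id e).rank_submatrix_le e' id)
    rw [Matrix.submatrix_submatrix] at h1
    have h2 : (A.submatrix e' e).rank = r := by rw [Matrix.rank_of_isUnit _ hu, Fintype.card_fin]
    rw [hA]
    exact h2.symm.le.trans h1
  have heq := Submodule.eq_of_le_of_finrank_le hle hrank
  have hex : ∀ j, ∃ z : Fin r → F, A.submatrix id e *ᵥ z = A.col j := by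
    intro j
    have : A.col j ∈ LinearMap.range A.mulVecLin :=
      ⟨Pi.single j 1, by rw [Matrix.mulVecLin_apply, Matrix.mulVec_single_one]⟩
    rw [← heq] at this
    exact this
  choose z hz using hex
  -- The columns `e` span the column space, so `A = X Z` with `X` these columns; reading off the
  -- rows `e'` gives `Z = G⁻¹ Y`, with `G` the block and `Y` the rows `e'`.
  have hZ : A.submatrix id e * Matrix.of (fun i j => z j i) = A := by
    ext i j
    exact congrFun (hz j) i
  have hrow : A.submatrix e' id = A.submatrix e' e * Matrix.of (fun i j => z j i) := by
    conv_lhs => rw [← hZ]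
    rfl
  have hdet := (Matrix.isUnit_iff_isUnit_det _).1 hu
  rw [hrow, Matrix.mul_assoc, Matrix.nonsing_inv_mul_cancel_left _ _ hdet, hZ]

open scoped Classical in
/-- The pairs of ordered `r`-tuples of rows and columns of `A` that meet in a nonsingular
matrix. -/
noncomputable def nonsingularMinors (r : ℕ) (A : Matrix (Fin b) (Fin a) F) :
    Finset ((Fin r ↪ Fin b) × (Fin r ↪ Fin a)) :=
  Finset.univ.filter fun p => IsUnit (A.submatrix p.1 p.2)

theorem mem_nonsingularMinors {A : Matrix (Fin b) (Fin a) F}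
    {p : (Fin r ↪ Fin b) × (Fin r ↪ Fin a)} :
    p ∈ nonsingularMinors r A ↔ IsUnit (A.submatrix p.1 p.2) := by
  simp [nonsingularMinors]

theorem nonsingularMinors_nonempty {A : Matrix (Fin b) (Fin a) F} (hA : A.rank = r) :
    (nonsingularMinors r A).Nonempty := by
  obtain ⟨e', e, h⟩ := exists_isUnit_submatrix A hA
  exact ⟨(e', e), mem_nonsingularMinors.2 h⟩

/-- `A` has rank `r` and `p` is the representative of its set of nonsingular minors. -/
def IsPivot (r : ℕ) (A : Matrix (Fin b) (Fin a) F)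
    (p : (Fin r ↪ Fin b) × (Fin r ↪ Fin a)) : Prop :=
  A.rank = r ∧ ∃ h : (nonsingularMinors r A).Nonempty, h.choose = p

theorem IsPivot.isUnit {A : Matrix (Fin b) (Fin a) F} {p : (Fin r ↪ Fin b) × (Fin r ↪ Fin a)}
    (h : IsPivot r A p) : IsUnit (A.submatrix p.1 p.2) := by
  obtain ⟨-, hne, rfl⟩ := h
  exact mem_nonsingularMinors.1 hne.choose_spec

theorem exists_isPivot {A : Matrix (Fin b) (Fin a) F} (hA : A.rank = r) : ∃ p, IsPivot r A p :=
  ⟨_, hA, nonsingularMinors_nonempty hA, rfl⟩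

theorem IsPivot.unique {A : Matrix (Fin b) (Fin a) F} {p q : (Fin r ↪ Fin b) × (Fin r ↪ Fin a)}
    (hp : IsPivot r A p) (hq : IsPivot r A q) : p = q := by
  obtain ⟨-, _, rfl⟩ := hp
  obtain ⟨-, _, rfl⟩ := hq
  rfl

/-- The pivot is chosen from the set of nonsingular minors alone, not from the matrix; this keeps it
fixed under `changeMinor`. -/
theorem IsPivot.congr {A B : Matrix (Fin b) (Fin a) F} {p : (Fin r ↪ Fin b) × (Fin r ↪ Fin a)}
    (h : IsPivot r A p) (hB : B.rank = r) (hAB : nonsingularMinors r B = nonsingularMinors r A) :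
    IsPivot r B p := by
  refine ⟨hB, ?_⟩
  rw [hAB]
  exact h.2

/-- Replace the submatrix `p` of `A` by `G'`, keeping the row space and the column space. -/
noncomputable def changeMinor (p : (Fin r ↪ Fin b) × (Fin r ↪ Fin a))
    (G' : Matrix (Fin r) (Fin r) F) (A : Matrix (Fin b) (Fin a) F) : Matrix (Fin b) (Fin a) F :=
  A.submatrix id p.2 * ((A.submatrix p.1 p.2)⁻¹ * G' * (A.submatrix p.1 p.2)⁻¹) *
    A.submatrix p.1 id

theorem changeMinor_submatrix (p : (Fin r ↪ Fin b) × (Fin r ↪ Fin a))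
    (G' : Matrix (Fin r) (Fin r) F) (A : Matrix (Fin b) (Fin a) F) {s t : Type*}
    (f : s → Fin b) (g : t → Fin a) :
    (changeMinor p G' A).submatrix f g =
      A.submatrix f p.2 * ((A.submatrix p.1 p.2)⁻¹ * G' * (A.submatrix p.1 p.2)⁻¹) *
        A.submatrix p.1 g := rfl

variable {p : (Fin r ↪ Fin b) × (Fin r ↪ Fin a)} {G' : Matrix (Fin r) (Fin r) F}
  {A : Matrix (Fin b) (Fin a) F}

theorem changeMinor_submatrix_self (hA : IsUnit (A.submatrix p.1 p.2)) :
    (changeMinor p G' A).submatrix p.1 p.2 = G' := by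
  have hdet := (Matrix.isUnit_iff_isUnit_det _).1 hA
  rw [changeMinor_submatrix, Matrix.mul_assoc, Matrix.mul_assoc, Matrix.mul_assoc,
    Matrix.nonsing_inv_mul _ hdet, Matrix.mul_one, Matrix.mul_nonsing_inv_cancel_left _ _ hdet]

theorem changeMinor_rank (hA : IsUnit (A.submatrix p.1 p.2)) (hG' : IsUnit G') :
    (changeMinor p G' A).rank = r := by
  refine le_antisymm ?_ ?_
  · refine (Matrix.rank_mul_le_right _ _).trans ?_
    simpa using (A.submatrix p.1 id).rank_le_height
  · have h := (changeMinor p G' A).rank_submatrix_le p.1 p.2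
    rwa [changeMinor_submatrix_self hA, Matrix.rank_of_isUnit _ hG', Fintype.card_fin] at h

/-- Before and after the change, the minor at `q` is `A[q.1, p.2]` times an invertible matrix times
`A[p.1, q.2]`, so only these two outer factors decide whether it is nonsingular. -/
theorem nonsingularMinors_changeMinor (hA : A.rank = r) (hu : IsUnit (A.submatrix p.1 p.2))
    (hG' : IsUnit G') : nonsingularMinors r (changeMinor p G' A) = nonsingularMinors r A := by
  have hinv : IsUnit (A.submatrix p.1 p.2)⁻¹.det :=
    Matrix.isUnit_nonsing_inv_det _ ((Matrix.isUnit_iff_isUnit_det _).1 hu)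
  have hG'd := (Matrix.isUnit_iff_isUnit_det _).1 hG'
  ext q
  rw [mem_nonsingularMinors, mem_nonsingularMinors, changeMinor_submatrix]
  have h2 : A.submatrix q.1 q.2 =
      A.submatrix q.1 p.2 * (A.submatrix p.1 p.2)⁻¹ * A.submatrix p.1 q.2 := by
    conv_lhs => rw [← eq_mul_inv_mul_of_rank_eq A hA p.1 p.2 hu]
    rfl
  rw [h2, Matrix.isUnit_iff_isUnit_det, Matrix.isUnit_iff_isUnit_det]
  simp only [Matrix.det_mul, IsUnit.mul_iff, hinv, hG'd, and_true]

theorem IsPivot.changeMinor (h : IsPivot r A p) (hG' : IsUnit G') :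
    IsPivot r (changeMinor p G' A) p :=
  h.congr (changeMinor_rank h.isUnit hG') (nonsingularMinors_changeMinor h.1 h.isUnit hG')

/-- Restoring the original block undoes the change: a matrix of rank `r` is `X G⁻¹ Y`, and the
change multiplies `X` by `G⁻¹ G'` on the right and `Y` by `G' G⁻¹` on the left. -/
theorem changeMinor_changeMinor (h : IsPivot r A p) (hG' : IsUnit G') :
    RelayNetwork.changeMinor p (A.submatrix p.1 p.2) (RelayNetwork.changeMinor p G' A) = A := by
  have hdet := (Matrix.isUnit_iff_isUnit_det _).1 h.isUnit
  have hdet' := (Matrix.isUnit_iff_isUnit_det _).1 hG'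
  conv_rhs => rw [← eq_mul_inv_mul_of_rank_eq A h.1 p.1 p.2 h.isUnit]
  conv_lhs => rw [RelayNetwork.changeMinor]
  rw [changeMinor_submatrix_self h.isUnit, changeMinor_submatrix, changeMinor_submatrix]
  set G := A.submatrix p.1 p.2
  set X := A.submatrix id p.2
  set Y := A.submatrix p.1 id
  calc X * (G⁻¹ * G' * G⁻¹) * G * (G'⁻¹ * G * G'⁻¹) * (G * (G⁻¹ * G' * G⁻¹) * Y)
      = X * G⁻¹ * G' * (G⁻¹ * G) * G'⁻¹ * G * G'⁻¹ * (G * G⁻¹) * G' * G⁻¹ * Y := by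
        simp only [Matrix.mul_assoc]
    _ = X * G⁻¹ * (G' * G'⁻¹) * G * (G'⁻¹ * G') * G⁻¹ * Y := by
        rw [Matrix.nonsing_inv_mul _ hdet, Matrix.mul_nonsing_inv _ hdet]
        simp only [Matrix.mul_assoc, Matrix.one_mul]
    _ = X * (G⁻¹ * G) * G⁻¹ * Y := by
        rw [Matrix.nonsing_inv_mul _ hdet', Matrix.mul_nonsing_inv _ hdet']
        simp only [Matrix.mul_assoc, Matrix.one_mul]
    _ = X * G⁻¹ * Y := by
        rw [Matrix.nonsing_inv_mul _ hdet, Matrix.mul_one]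

end Minors

section Counting

variable {F : Type*} [Field F] [Fintype F] {a b r : ℕ}

open scoped Classical in
-- `changeMinor p G'` maps the first set into the second, and it is injective because the block `G`
-- to be restored is known.
theorem card_isPivot_le (p : (Fin r ↪ Fin b) × (Fin r ↪ Fin a)) {G G' : Matrix (Fin r) (Fin r) F}
    (hG' : IsUnit G') :
    (Finset.univ.filter fun A : Matrix (Fin b) (Fin a) F =>
      IsPivot r A p ∧ A.submatrix p.1 p.2 = G).card ≤
    (Finset.univ.filter fun A : Matrix (Fin b) (Fin a) F =>
      IsPivot r A p ∧ A.submatrix p.1 p.2 = G').card := by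
  refine Finset.card_le_card_of_injOn (changeMinor p G') ?_ ?_
  · intro A hA
    simp only [Finset.coe_filter, Finset.mem_univ, true_and, Set.mem_ofPred_eq] at hA ⊢
    exact ⟨hA.1.changeMinor hG', changeMinor_submatrix_self hA.1.isUnit⟩
  · intro A hA B hB hAB
    simp only [Finset.coe_filter, Finset.mem_univ, true_and, Set.mem_ofPred_eq] at hA hB
    rw [← changeMinor_changeMinor hA.1 hG', ← changeMinor_changeMinor hB.1 hG', hAB, hA.2, hB.2]

open scoped Classical in
theorem card_isPivot_eq (p : (Fin r ↪ Fin b) × (Fin r ↪ Fin a)) {G G' : Matrix (Fin r) (Fin r) F}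
    (hG : IsUnit G) (hG' : IsUnit G') :
    (Finset.univ.filter fun A : Matrix (Fin b) (Fin a) F =>
      IsPivot r A p ∧ A.submatrix p.1 p.2 = G).card =
    (Finset.univ.filter fun A : Matrix (Fin b) (Fin a) F =>
      IsPivot r A p ∧ A.submatrix p.1 p.2 = G').card :=
  le_antisymm (card_isPivot_le p hG') (card_isPivot_le p hG)

variable {k k' : ℕ}

/-- A submatrix of a uniform matrix is uniform. -/
theorem card_filter_submatrix (α : Fin b ↪ Fin k') (β : Fin a ↪ Fin k)
    (P : Matrix (Fin b) (Fin a) F → Prop) [DecidablePred P] :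
    (Finset.univ.filter fun A : Matrix (Fin k') (Fin k) F => P (A.submatrix α β)).card *
      Fintype.card (Matrix (Fin b) (Fin a) F) =
    Fintype.card (Matrix (Fin k') (Fin k) F) * (Finset.univ.filter P).card := by
  classical
  -- Restriction is a surjective additive homomorphism, so its fibres have equal size.
  let f : Matrix (Fin k') (Fin k) F →+ Matrix (Fin b) (Fin a) F :=
    { toFun := fun A => A.submatrix α β
      map_zero' := rfl
      map_add' := fun _ _ => rfl }
  have hsurj : Function.Surjective f := by
    intro B
    refine ⟨Matrix.of fun i j => Function.extend α (fun i' => Function.extend β (B i') 0 j) 0 i, ?_⟩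
    ext i j
    change Function.extend α (fun i' => Function.extend β (B i') 0 (β j)) 0 (α i) = B i j
    rw [α.injective.extend_apply, β.injective.extend_apply]
  have hfib : ∀ B, (Finset.univ.filter fun A => f A = B).card =
      (Finset.univ.filter fun A => f A = 0).card :=
    fun B => AddMonoidHom.card_fiber_eq_of_mem_range f (hsurj B) (hsurj 0)
  have hP : ∀ (Q : Matrix (Fin b) (Fin a) F → Prop) [DecidablePred Q],
      (Finset.univ.filter fun A : Matrix (Fin k') (Fin k) F => Q (A.submatrix α β)).card =
      (Finset.univ.filter Q).card * (Finset.univ.filter fun A => f A = 0).card := by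
    intro Q _
    change (Finset.univ.filter fun A => Q (f A)).card = _
    rw [Finset.card_eq_sum_card_fiberwise (f := f) (t := Finset.univ.filter Q)
      (fun A hA => Finset.mem_coe.2 (Finset.mem_filter.2
        ⟨Finset.mem_univ _, (Finset.mem_filter.1 (Finset.mem_coe.1 hA)).2⟩)), ← smul_eq_mul, ← Finset.sum_const]
    refine Finset.sum_congr rfl fun B hB => ?_
    rw [← hfib B]
    congr 1
    ext A
    simp only [Finset.mem_filter, Finset.mem_univ, true_and, and_iff_right_iff_imp] at hB ⊢
    rintro rfl
    exact hB
  have htot := hP fun _ => True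
  simp only [Finset.filter_true, Finset.card_univ] at htot
  rw [hP P, htot]
  ring

end Counting

end RelayNetwork

/-! ### Coupling a uniform matrix with the pivot of a random submatrix. -/

namespace RelayNetwork

section HopWeights

variable {F : Type*} [Field F] {a b r k k' : ℕ}

/-- `(e', e)` is the pivot of the submatrix `(α, β)` of the matrix `A`, for `u = (A, α, β)`. -/
def IsSubPivot (r : ℕ)
    (u : Matrix (Fin k') (Fin k) F × (Fin b ↪ Fin k') × (Fin a ↪ Fin k))
    (p : (Fin r ↪ Fin k') × (Fin r ↪ Fin k)) : Prop :=
  ∃ q, IsPivot r (u.1.submatrix u.2.1 u.2.2) q ∧ q.1.trans u.2.1 = p.1 ∧ q.2.trans u.2.2 = p.2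

variable {u : Matrix (Fin k') (Fin k) F × (Fin b ↪ Fin k') × (Fin a ↪ Fin k)}
  {p : (Fin r ↪ Fin k') × (Fin r ↪ Fin k)}

theorem IsSubPivot.isUnit (h : IsSubPivot r u p) : IsUnit (u.1.submatrix p.1 p.2) := by
  obtain ⟨q, hq, h1, h2⟩ := h
  rw [← h1, ← h2]
  exact hq.isUnit

theorem IsSubPivot.rank_eq (h : IsSubPivot r u p) : (u.1.submatrix u.2.1 u.2.2).rank = r := by
  obtain ⟨q, hq, -⟩ := h
  exact hq.1

theorem IsSubPivot.unique {p' : (Fin r ↪ Fin k') × (Fin r ↪ Fin k)} (h : IsSubPivot r u p)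
    (h' : IsSubPivot r u p') : p = p' := by
  obtain ⟨q, hq, h1, h2⟩ := h
  obtain ⟨q', hq', h1', h2'⟩ := h'
  obtain rfl := hq.unique hq'
  exact Prod.ext (h1.symm.trans h1') (h2.symm.trans h2')

theorem exists_isSubPivot (h : (u.1.submatrix u.2.1 u.2.2).rank = r) :
    ∃ p, IsSubPivot r u p := by
  obtain ⟨q, hq⟩ := exists_isPivot h
  exact ⟨(q.1.trans u.2.1, q.2.trans u.2.2), q, hq, rfl, rfl⟩

variable [Fintype F]

open scoped Classical in
/-- The number of triples `(A, α, β)` with pivot `p` and pivot submatrix `G`. -/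
noncomputable def subPivotCount (b a : ℕ) (p : (Fin r ↪ Fin k') × (Fin r ↪ Fin k))
    (G : Matrix (Fin r) (Fin r) F) : ℕ :=
  (Finset.univ.filter fun u : Matrix (Fin k') (Fin k) F × (Fin b ↪ Fin k') × (Fin a ↪ Fin k) =>
    IsSubPivot r u p ∧ u.1.submatrix p.1 p.2 = G).card

open scoped Classical in
-- For each placement `(α, β)` the condition concerns the submatrix only, which is uniform, so
-- `card_isPivot_eq` applies inside it.
theorem subPivotCount_congr_matrix (p : (Fin r ↪ Fin k') × (Fin r ↪ Fin k))
    {G G' : Matrix (Fin r) (Fin r) F} (hG : IsUnit G) (hG' : IsUnit G') :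
    subPivotCount b a p G = subPivotCount b a p G' := by
  have key : ∀ G : Matrix (Fin r) (Fin r) F, subPivotCount b a p G =
      ∑ v : (Fin b ↪ Fin k') × (Fin a ↪ Fin k),
        (Finset.univ.filter fun A : Matrix (Fin k') (Fin k) F =>
          IsSubPivot r (A, v) p ∧ A.submatrix p.1 p.2 = G).card := by
    intro G
    simp only [subPivotCount, Finset.card_filter]
    exact Fintype.sum_prod_type_right _
  rw [key, key]
  refine Finset.sum_congr rfl fun v _ => ?_
  obtain ⟨Q, hQdef⟩ : ∃ Q : Matrix (Fin r) (Fin r) F → Matrix (Fin b) (Fin a) F → Prop,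
      ∀ G B, Q G B ↔ ∃ q, IsPivot r B q ∧ q.1.trans v.1 = p.1 ∧
        q.2.trans v.2 = p.2 ∧ B.submatrix q.1 q.2 = G := ⟨_, fun _ _ => Iff.rfl⟩
  have hequiv : ∀ (G : Matrix (Fin r) (Fin r) F) (A : Matrix (Fin k') (Fin k) F),
      (IsSubPivot r (A, v) p ∧ A.submatrix p.1 p.2 = G) ↔ Q G (A.submatrix v.1 v.2) := by
    intro G A
    rw [hQdef]
    constructor
    · rintro ⟨⟨q, hq, h1, h2⟩, h3⟩
      refine ⟨q, hq, h1, h2, ?_⟩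
      rw [← h3, ← h1, ← h2]
      rfl
    · rintro ⟨q, hq, h1, h2, h3⟩
      refine ⟨⟨q, hq, h1, h2⟩, ?_⟩
      rw [← h3, ← h1, ← h2]
      rfl
  have hpos : 0 < Fintype.card (Matrix (Fin b) (Fin a) F) := Fintype.card_pos
  refine Nat.eq_of_mul_eq_mul_right hpos ?_
  have hcount : ∀ G : Matrix (Fin r) (Fin r) F,
      (Finset.univ.filter fun A : Matrix (Fin k') (Fin k) F =>
          IsSubPivot r (A, v) p ∧ A.submatrix p.1 p.2 = G).card *
        Fintype.card (Matrix (Fin b) (Fin a) F) =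
      Fintype.card (Matrix (Fin k') (Fin k) F) * (Finset.univ.filter (Q G)).card := by
    intro G
    rw [← card_filter_submatrix v.1 v.2 (Q G)]
    congr 2
    ext A
    rw [Finset.mem_filter, Finset.mem_filter, hequiv]
  refine (hcount G).trans (Eq.trans ?_ (hcount G').symm)
  congr 1
  -- Either `p` lies inside the placement, at a unique position `q` because the embeddings are
  -- injective, or both counts vanish.
  by_cases hex : ∃ q : (Fin r ↪ Fin b) × (Fin r ↪ Fin a),
      q.1.trans v.1 = p.1 ∧ q.2.trans v.2 = p.2
  · obtain ⟨q, h1, h2⟩ := hex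
    have huniq : ∀ q' : (Fin r ↪ Fin b) × (Fin r ↪ Fin a),
        q'.1.trans v.1 = p.1 → q'.2.trans v.2 = p.2 → q' = q := by
      intro q' h1' h2'
      refine Prod.ext (DFunLike.ext _ _ fun i => ?_) (DFunLike.ext _ _ fun i => ?_)
      · exact v.1.injective (DFunLike.congr_fun (h1'.trans h1.symm) i)
      · exact v.2.injective (DFunLike.congr_fun (h2'.trans h2.symm) i)
    have hQ : ∀ (G : Matrix (Fin r) (Fin r) F) (B : Matrix (Fin b) (Fin a) F),
        Q G B ↔ IsPivot r B q ∧ B.submatrix q.1 q.2 = G := by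
      intro G B
      rw [hQdef]
      constructor
      · rintro ⟨q', hq', h1', h2', h3'⟩
        obtain rfl := huniq q' h1' h2'
        exact ⟨hq', h3'⟩
      · rintro ⟨hq, h3⟩
        exact ⟨q, hq, h1, h2, h3⟩
    simp only [hQ]
    exact card_isPivot_eq q hG hG'
  · have hQ : ∀ (G : Matrix (Fin r) (Fin r) F) (B : Matrix (Fin b) (Fin a) F),
        ¬ Q G B := by
      rintro G B hGB
      obtain ⟨q, _, h1, h2, _⟩ := (hQdef G B).1 hGB
      exact hex ⟨q, h1, h2⟩
    simp only [hQ]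

theorem exists_perm_trans_eq {s t : ℕ} (e f : Fin s ↪ Fin t) :
    ∃ σ : Equiv.Perm (Fin t), e.trans σ.toEmbedding = f := by
  have := Equiv.Perm.isMultiplyPretransitive (Fin t) s
  obtain ⟨σ, h⟩ := MulAction.exists_smul_eq (Equiv.Perm (Fin t)) e f
  exact ⟨σ, by rw [← h]; rfl⟩

/-- Permuting the rows and the columns of a matrix and of its distinguished submatrix. -/
def permEquiv (σ : Equiv.Perm (Fin k')) (τ : Equiv.Perm (Fin k)) :
    (Matrix (Fin k') (Fin k) F × (Fin b ↪ Fin k') × (Fin a ↪ Fin k)) ≃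
      (Matrix (Fin k') (Fin k) F × (Fin b ↪ Fin k') × (Fin a ↪ Fin k)) where
  toFun u := (u.1.submatrix σ.symm τ.symm, u.2.1.trans σ.toEmbedding, u.2.2.trans τ.toEmbedding)
  invFun u := (u.1.submatrix σ τ, u.2.1.trans σ.symm.toEmbedding, u.2.2.trans τ.symm.toEmbedding)
  left_inv u := by
    refine Prod.ext ?_ (Prod.ext ?_ ?_)
    · ext i j; simp
    · ext i; simp
    · ext i; simp
  right_inv u := by
    refine Prod.ext ?_ (Prod.ext ?_ ?_)
    · ext i j; simp
    · ext i; simp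
    · ext i; simp

/-- The purpose of the random placement. Permuting rows and columns together with `(α, β)` leaves
the `b × a` submatrix unchanged, hence also its arbitrarily chosen pivot, while moving the position
in the large matrix anywhere. -/
theorem subPivotCount_congr_pivot (p q : (Fin r ↪ Fin k') × (Fin r ↪ Fin k))
    (G : Matrix (Fin r) (Fin r) F) : subPivotCount b a p G = subPivotCount b a q G := by
  classical
  obtain ⟨σ, hσ⟩ := exists_perm_trans_eq p.1 q.1
  obtain ⟨τ, hτ⟩ := exists_perm_trans_eq p.2 q.2
  rw [subPivotCount, subPivotCount]
  refine Finset.card_equiv (permEquiv σ τ) fun u => ?_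
  have hsub : ((permEquiv σ τ u).1.submatrix (permEquiv σ τ u).2.1 (permEquiv σ τ u).2.2) =
      u.1.submatrix u.2.1 u.2.2 := by
    ext i j
    simp [permEquiv]
  have hsub2 : (permEquiv σ τ u).1.submatrix q.1 q.2 = u.1.submatrix p.1 p.2 := by
    ext i j
    simp [permEquiv, ← hσ, ← hτ]
  have hσ' : ∀ e : Fin r ↪ Fin b,
      e.trans (permEquiv σ τ u).2.1 = q.1 ↔ e.trans u.2.1 = p.1 := by
    intro e
    rw [← hσ]
    constructor
    · intro h
      ext i
      have := DFunLike.congr_fun h i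
      exact congrArg _ (σ.injective this)
    · intro h
      rw [← h]
      rfl
  have hτ' : ∀ e : Fin r ↪ Fin a,
      e.trans (permEquiv σ τ u).2.2 = q.2 ↔ e.trans u.2.2 = p.2 := by
    intro e
    rw [← hτ]
    constructor
    · intro h
      ext i
      have := DFunLike.congr_fun h i
      exact congrArg _ (τ.injective this)
    · intro h
      rw [← h]
      rfl
  rw [Finset.mem_filter, Finset.mem_filter]
  simp only [Finset.mem_univ, true_and, IsSubPivot, hsub, hsub2, hσ', hτ']

variable (F) in
/-- The probability that a uniform `b × a` matrix has rank `r`. -/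
noncomputable def rankLaw (b a r : ℕ) : ℝ :=
  ((Finset.univ.filter fun A : Matrix (Fin b) (Fin a) F => A.rank = r).card : ℝ) /
    Fintype.card (Matrix (Fin b) (Fin a) F)

/-- Lets a hop that accommodates the dimensions of hop `m₀` only after exchanging its ends carry the
same law of `r`. -/
theorem rankLaw_transpose (b a r : ℕ) : rankLaw F b a r = rankLaw F a b r := by
  have h1 : (Finset.univ.filter fun A : Matrix (Fin b) (Fin a) F => A.rank = r).card =
      (Finset.univ.filter fun A : Matrix (Fin a) (Fin b) F => A.rank = r).card :=
    Finset.card_equiv (Matrix.transposeAddEquiv (Fin b) (Fin a) F).toEquiv fun A => by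
      simp [Matrix.rank_transpose]
  have h2 : Fintype.card (Matrix (Fin b) (Fin a) F) = Fintype.card (Matrix (Fin a) (Fin b) F) :=
    Fintype.card_congr (Matrix.transposeAddEquiv (Fin b) (Fin a) F).toEquiv
  rw [rankLaw, rankLaw, h1, h2]

open scoped Classical in
-- The triples of rank `r` are partitioned by the position and the value of their pivot block, and
-- all classes have the same size.
theorem card_isSubPivot (p : (Fin r ↪ Fin k') × (Fin r ↪ Fin k))
    {G : Matrix (Fin r) (Fin r) F} (hG : IsUnit G) :
    subPivotCount b a p G *
      (Fintype.card (Fin r ↪ Fin k') * Fintype.card (Fin r ↪ Fin k) *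
        Fintype.card (Matrix (Fin r) (Fin r) F)ˣ) =
    (Finset.univ.filter fun u : Matrix (Fin k') (Fin k) F × (Fin b ↪ Fin k') × (Fin a ↪ Fin k) =>
      (u.1.submatrix u.2.1 u.2.2).rank = r).card := by
  have h1 : (Finset.univ.filter
      fun u : Matrix (Fin k') (Fin k) F × (Fin b ↪ Fin k') × (Fin a ↪ Fin k) =>
      (u.1.submatrix u.2.1 u.2.2).rank = r).card =
      ∑ x : ((Fin r ↪ Fin k') × (Fin r ↪ Fin k)) × (Matrix (Fin r) (Fin r) F)ˣ,
        subPivotCount b a x.1 (x.2 : Matrix (Fin r) (Fin r) F) := by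
    simp only [subPivotCount]
    rw [← Finset.card_biUnion]
    · congr 1
      ext u
      simp only [Finset.mem_filter, Finset.mem_univ, true_and, Finset.mem_biUnion]
      constructor
      · intro h
        obtain ⟨p, hp⟩ := exists_isSubPivot h
        exact ⟨(p, hp.isUnit.unit), hp, rfl⟩
      · rintro ⟨x, hx, -⟩
        exact hx.rank_eq
    · intro x _ y _ hxy
      rw [Function.onFun, Finset.disjoint_left]
      intro u hu hu'
      simp only [Finset.mem_filter, Finset.mem_univ, true_and] at hu hu'
      obtain ⟨x1, x2⟩ := x
      obtain ⟨y1, y2⟩ := y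
      obtain rfl : x1 = y1 := hu.1.unique hu'.1
      obtain rfl : x2 = y2 := Units.ext (hu.2.symm.trans hu'.2)
      exact hxy rfl
  have h2 : ∀ x : ((Fin r ↪ Fin k') × (Fin r ↪ Fin k)) × (Matrix (Fin r) (Fin r) F)ˣ,
      subPivotCount b a x.1 (x.2 : Matrix (Fin r) (Fin r) F) = subPivotCount b a p G := fun x =>
    (subPivotCount_congr_matrix x.1 x.2.isUnit hG).trans (subPivotCount_congr_pivot _ _ _)
  rw [h1, Finset.sum_congr rfl fun x _ => h2 x, Finset.sum_const, Finset.card_univ,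
    Fintype.card_prod, Fintype.card_prod, smul_eq_mul, mul_comm]

open scoped Classical in
theorem card_rank_submatrix (b a k' k r : ℕ) :
    (Finset.univ.filter fun u : Matrix (Fin k') (Fin k) F × (Fin b ↪ Fin k') × (Fin a ↪ Fin k) =>
      (u.1.submatrix u.2.1 u.2.2).rank = r).card *
      Fintype.card (Matrix (Fin b) (Fin a) F) =
    Fintype.card (Matrix (Fin k') (Fin k) F × (Fin b ↪ Fin k') × (Fin a ↪ Fin k)) *
      (Finset.univ.filter fun A : Matrix (Fin b) (Fin a) F => A.rank = r).card := by
  have h : (Finset.univ.filter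
      fun u : Matrix (Fin k') (Fin k) F × (Fin b ↪ Fin k') × (Fin a ↪ Fin k) =>
      (u.1.submatrix u.2.1 u.2.2).rank = r).card =
      ∑ v : (Fin b ↪ Fin k') × (Fin a ↪ Fin k),
        (Finset.univ.filter fun A : Matrix (Fin k') (Fin k) F =>
          (A.submatrix v.1 v.2).rank = r).card := by
    simp only [Finset.card_filter]
    exact Fintype.sum_prod_type_right _
  rw [h, Finset.sum_mul, Finset.sum_congr rfl fun v _ => card_filter_submatrix v.1 v.2
    (fun A : Matrix (Fin b) (Fin a) F => A.rank = r), Finset.sum_const, Finset.card_univ,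
    smul_eq_mul, Fintype.card_prod (Matrix (Fin k') (Fin k) F)]
  ring

variable (F) in
open scoped Classical in
/-- If `b ≤ k'` and `a ≤ k`, a uniform `k' × k` matrix `A` can be coupled with ordered tuples
`e'`, `e` of `r` rows and columns, `r` being distributed as the rank of a uniform `b × a` matrix,
such that given `r` the submatrix `(e', e)` is uniform on the invertible matrices and independent
of the uniform `e'` and `e`. -/
theorem exists_hopWeights {b a k' k : ℕ} (hb : b ≤ k') (ha : a ≤ k) :
    ∃ w : (r : ℕ) → Matrix (Fin k') (Fin k) F → (Fin r ↪ Fin k') → (Fin r ↪ Fin k) → ℝ,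
      (∀ r A e' e, 0 ≤ w r A e' e) ∧
      (∀ r e' e (G : (Matrix (Fin r) (Fin r) F)ˣ),
        (∑ A, if A.submatrix e' e = (G : Matrix (Fin r) (Fin r) F) then w r A e' e else 0) *
          (Fintype.card (Fin r ↪ Fin k') * Fintype.card (Fin r ↪ Fin k) *
            Fintype.card (Matrix (Fin r) (Fin r) F)ˣ) = rankLaw F b a r) ∧
      ∀ s A, ∑ r ∈ Finset.range s, ∑ e', ∑ e, w r A e' e ≤
        1 / Fintype.card (Matrix (Fin k') (Fin k) F) := by
  have hα : Nonempty (Fin b ↪ Fin k') := ⟨Fin.castLEEmb hb⟩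
  have hβ : Nonempty (Fin a ↪ Fin k) := ⟨Fin.castLEEmb ha⟩
  set U := Matrix (Fin k') (Fin k) F × (Fin b ↪ Fin k') × (Fin a ↪ Fin k) with hU
  have hU0 : (0 : ℝ) < Fintype.card U := Nat.cast_pos.2 Fintype.card_pos
  have hM0 : (0 : ℝ) < Fintype.card (Matrix (Fin b) (Fin a) F) := Nat.cast_pos.2 Fintype.card_pos
  -- The probability, for independent uniform `A`, `α`, `β`, that the matrix is `A` and the pivot
  -- has order `r` and position `(e', e)`.
  refine ⟨fun r A e' e => ((Finset.univ.filter fun v : (Fin b ↪ Fin k') × (Fin a ↪ Fin k) =>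
    IsSubPivot r (A, v) (e', e)).card : ℝ) / Fintype.card U, fun r A e' e => by positivity, ?_, ?_⟩
  · intro r e' e G
    have h1 : (∑ A : Matrix (Fin k') (Fin k) F, if A.submatrix e' e = (G : Matrix (Fin r) (Fin r) F) then
        ((Finset.univ.filter fun v : (Fin b ↪ Fin k') × (Fin a ↪ Fin k) =>
          IsSubPivot r (A, v) (e', e)).card : ℝ) / Fintype.card U else 0) =
        (subPivotCount b a (e', e) (G : Matrix (Fin r) (Fin r) F) : ℝ) / Fintype.card U := by
      rw [subPivotCount, Finset.card_filter, Fintype.sum_prod_type]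
      push_cast
      rw [Finset.sum_div]
      refine Finset.sum_congr rfl fun A _ => ?_
      split_ifs with h
      · rw [Finset.card_filter]
        push_cast
        simp [h]
      · simp [h]
    rw [h1, rankLaw, div_mul_eq_mul_div, div_eq_div_iff hU0.ne' hM0.ne']
    have h2 := card_isSubPivot (b := b) (a := a) (e', e) G.isUnit
    have h3 := card_rank_submatrix (F := F) b a k' k r
    rw [← h2] at h3
    rw [mul_comm _ (Fintype.card U : ℝ)]
    exact_mod_cast h3
  · intro s A
    simp only [← Finset.sum_div, ← Nat.cast_sum]
    rw [div_le_div_iff₀ hU0 (Nat.cast_pos.2 Fintype.card_pos), one_mul]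
    -- For fixed `A`, each placement is counted for at most one `r` and one position.
    have h1 : ∑ r ∈ Finset.range s, ∑ e' : Fin r ↪ Fin k', ∑ e : Fin r ↪ Fin k,
        (Finset.univ.filter fun v : (Fin b ↪ Fin k') × (Fin a ↪ Fin k) =>
          IsSubPivot r (A, v) (e', e)).card ≤
        Fintype.card ((Fin b ↪ Fin k') × (Fin a ↪ Fin k)) := by
      have h2 : ∀ r, ∑ e' : Fin r ↪ Fin k', ∑ e : Fin r ↪ Fin k,
        (Finset.univ.filter fun v : (Fin b ↪ Fin k') × (Fin a ↪ Fin k) =>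
          IsSubPivot r (A, v) (e', e)).card ≤
        (Finset.univ.filter fun v : (Fin b ↪ Fin k') × (Fin a ↪ Fin k) =>
          (A.submatrix v.1 v.2).rank = r).card := by
        intro r
        rw [← Fintype.sum_prod_type', ← Finset.card_biUnion]
        · refine Finset.card_le_card fun v hv => ?_
          simp only [Finset.mem_filter, Finset.mem_univ, true_and, Finset.mem_biUnion] at hv ⊢
          obtain ⟨p, hp⟩ := hv
          exact hp.rank_eq
        · intro x _ y _ hxy
          rw [Function.onFun, Finset.disjoint_left]
          intro v hv hv'
          simp only [Finset.mem_filter, Finset.mem_univ, true_and] at hv hv'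
          exact hxy (hv.unique hv')
      refine (Finset.sum_le_sum fun r _ => h2 r).trans ?_
      rw [← Finset.card_biUnion]
      · exact Finset.card_le_univ _
      · intro x _ y _ hxy
        rw [Function.onFun, Finset.disjoint_left]
        intro v hv hv'
        simp only [Finset.mem_filter, Finset.mem_univ, true_and] at hv hv'
        exact hxy (hv.symm.trans hv')
    rw [show Fintype.card U = _ from Fintype.card_prod _ _, Nat.cast_mul, mul_comm]
    exact mul_le_mul_of_nonneg_left (by exact_mod_cast h1) (by positivity)

end HopWeights

end RelayNetwork

/-! ### Layer states and telescoping packets. -/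

namespace RelayNetwork

theorem card_binary_matrix (k' k : ℕ) :
    Fintype.card (Matrix (Fin k') (Fin k) (ZMod 2)) = 2 ^ (k' * k) := by
  have : Fintype.card (Matrix (Fin k') (Fin k) (ZMod 2)) =
      Fintype.card (Fin k' → Fin k → ZMod 2) := rfl
  rw [this, Fintype.card_fun, Fintype.card_fun, ZMod.card, Fintype.card_fin, Fintype.card_fin,
    ← pow_mul, mul_comm]

theorem mulVec_comp_embedding {F : Type*} [Field F] {k k' r : ℕ} (A : Matrix (Fin k') (Fin k) F)
    (e' : Fin r ↪ Fin k') (e : Fin r ↪ Fin k) (v : Fin k → F)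
    (hv : ∀ i, i ∉ Set.range e → v i = 0) :
    (A *ᵥ v) ∘ e' = A.submatrix e' e *ᵥ (v ∘ e) := by
  funext j
  exact (Fintype.sum_of_injective e e.injective _ _ (fun i hi => by simp [hv i hi])
    (fun i => rfl)).symm

/-- The active nodes of a layer of size `k`, in order, with the linear transformation of the
packet that they hold. -/
abbrev LayerState (r k : ℕ) : Type :=
  (Fin r ↪ Fin k) × (Matrix (Fin r) (Fin r) (ZMod 2))ˣ

theorem LayerState.cast_fst {r k k' : ℕ} (h : k = k') (y : LayerState r k) (i : Fin r) :
    (h ▸ y : LayerState r k').1 i = Fin.cast h (y.1 i) := by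
  subst h
  rfl

theorem LayerState.cast_snd {r k k' : ℕ} (h : k = k') (y : LayerState r k) :
    (h ▸ y : LayerState r k').2 = y.2 := by
  subst h
  rfl

variable {N : RelayNetwork}

section NextLayer

variable {X : ℕ → Type}

theorem K_next (m : Fin N.M) (h : ¬ (m : ℕ) + 1 < N.M) : N.K 0 = N.K (m + 1) := by
  have := m.isLt
  rw [show (m : ℕ) + 1 = N.M by omega, N.K_last]

/-- The entry of layer `m + 1` of a family indexed by the transmitting layers, the destinations
being identified with the sources. -/
def nextLayer (x : ∀ l : Fin N.M, X (N.K l)) (m : Fin N.M) : X (N.K (m + 1)) :=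
  if h : (m : ℕ) + 1 < N.M then x ⟨m + 1, h⟩ else K_next m h ▸ x ⟨0, N.M_pos⟩

/-- The two ends of a hop carry independent states: with at least two hops they are distinct
coordinates, even on the last hop, whose receivers reuse the state of the sources. -/
theorem sum_nextLayer [∀ k, Fintype (X k)] (hM : 2 ≤ N.M) (c : ℕ → ℝ)
    (hc : ∀ l : Fin N.M, ∑ _y : X (N.K l), c (N.K l) = 1) (m : Fin N.M)
    (Φ : X (N.K (m + 1)) → X (N.K m) → ℝ) :
    ∑ x : ∀ l : Fin N.M, X (N.K l), (∏ l : Fin N.M, c (N.K l)) * Φ (nextLayer x m) (x m) =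
      ∑ y, ∑ z, c (N.K (m + 1)) * c (N.K m) * Φ y z := by
  by_cases h : (m : ℕ) + 1 < N.M
  · simp only [nextLayer, dif_pos h]
    refine sum_prod_mul_apply₂ (α := fun l : Fin N.M => X (N.K l)) (fun l _ => c (N.K l)) hc
      (i := ⟨m + 1, h⟩) (j := m) (fun he => ?_) Φ
    have := congrArg Fin.val he
    simp at this
  · simp only [nextLayer, dif_neg h]
    have h0 : (⟨0, N.M_pos⟩ : Fin N.M) ≠ m := by
      intro he
      have := congrArg Fin.val he
      simp only at this
      omega
    refine (sum_prod_mul_apply₂ (α := fun l : Fin N.M => X (N.K l)) (fun l _ => c (N.K l)) hc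
      h0 (fun y z => Φ (K_next m h ▸ y) z)).trans ?_
    have hcast : ∀ {k k' : ℕ} (e : k = k') (Ψ : ℝ → X k' → ℝ),
        ∑ y : X k, Ψ (c k) (e ▸ y) = ∑ y, Ψ (c k') y := by
      intro k k' e Ψ
      subst e
      rfl
    exact hcast (K_next m h) fun d y => ∑ z, d * c (N.K m) * Φ y z

end NextLayer

/-- If consecutive layers are connected through matrices that telescope along the layers, the
packet is received without interference. -/
theorem isInterferenceFree_of_states {r : ℕ} (A : (m : Fin N.M) → N.HopMatrix m)
    (x : ∀ l : Fin N.M, LayerState r (N.K l))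
    (hA : ∀ m, (A m).submatrix (nextLayer x m).1 (x m).1 =
      ((nextLayer x m).2 * (x m).2⁻¹ : (Matrix (Fin r) (Fin r) (ZMod 2))ˣ)) :
    IsInterferenceFree A fun m => Set.range (x m).1 := by
  intro v k hk
  have hoff : ∀ (m : ℕ) (hm : m < N.M) (i : Fin (N.K m)), i ∉ Set.range (x ⟨m, hm⟩).1 →
      flow A (fun m => Set.range (x m).1) v m hm i = 0 := by
    intro m hm i hi
    cases m <;> exact Set.indicator_of_notMem hi _
  set u := v ∘ (x ⟨0, N.M_pos⟩).1 with hu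
  -- With `P_m` the invertible matrix in the state of layer `m`, its active nodes hold `P_m P_0⁻¹
  -- u`; the hop multiplies this by `P_{m+1} P_m⁻¹`. The destinations have `P_0` again and so
  -- receive `u`.
  have hstep : ∀ (m : ℕ) (hm : m < N.M),
      flow A (fun m => Set.range (x m).1) v m hm ∘ (x ⟨m, hm⟩).1 =
        (((x ⟨m, hm⟩).2 * (x ⟨0, N.M_pos⟩).2⁻¹ : (Matrix (Fin r) (Fin r) (ZMod 2))ˣ) :
          Matrix (Fin r) (Fin r) (ZMod 2)) *ᵥ u →
      (A ⟨m, hm⟩ *ᵥ flow A (fun m => Set.range (x m).1) v m hm) ∘ (nextLayer x ⟨m, hm⟩).1 =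
        (((nextLayer x ⟨m, hm⟩).2 * (x ⟨0, N.M_pos⟩).2⁻¹ :
          (Matrix (Fin r) (Fin r) (ZMod 2))ˣ) : Matrix (Fin r) (Fin r) (ZMod 2)) *ᵥ u := by
    intro m hm h
    rw [mulVec_comp_embedding _ _ (x ⟨m, hm⟩).1 _ (hoff m hm), h, hA ⟨m, hm⟩, Matrix.mulVec_mulVec,
      ← Units.val_mul]
    congr 2
    group
  have hflow : ∀ (m : ℕ) (hm : m < N.M),
      flow A (fun m => Set.range (x m).1) v m hm ∘ (x ⟨m, hm⟩).1 =
        (((x ⟨m, hm⟩).2 * (x ⟨0, N.M_pos⟩).2⁻¹ : (Matrix (Fin r) (Fin r) (ZMod 2))ˣ) :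
          Matrix (Fin r) (Fin r) (ZMod 2)) *ᵥ u := by
    intro m
    induction m with
    | zero =>
      intro hm
      rw [mul_inv_cancel, Units.val_one, Matrix.one_mulVec]
      funext i
      exact Set.indicator_of_mem (Set.mem_range_self i) _
    | succ m ih =>
      intro hm
      have h := hstep m (Nat.lt_of_succ_lt hm) (ih (Nat.lt_of_succ_lt hm))
      have hn : nextLayer x ⟨m, Nat.lt_of_succ_lt hm⟩ = x ⟨m + 1, hm⟩ := dif_pos hm
      rw [hn] at h
      rw [← h]
      funext i
      exact Set.indicator_of_mem (Set.mem_range_self i) _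
  obtain ⟨i, rfl⟩ := hk
  have hlast : ¬ ((Code.lastHop N : Fin N.M) : ℕ) + 1 < N.M := by
    have : ((Code.lastHop N : Fin N.M) : ℕ) = N.M - 1 := rfl
    omega
  have h := hstep _ (Code.lastHop N).isLt (hflow _ (Code.lastHop N).isLt)
  have hn : nextLayer x ⟨Code.lastHop N, (Code.lastHop N).isLt⟩ =
      K_next (Code.lastHop N) hlast ▸ x ⟨0, N.M_pos⟩ :=
    dif_neg hlast
  rw [hn, LayerState.cast_snd, mul_inv_cancel, Units.val_one, Matrix.one_mulVec] at h
  have hi := congrFun h i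
  rw [Function.comp_apply, LayerState.cast_fst] at hi
  exact hi

theorem hopProb_of_half (hp : ∀ m j i, N.p m j i = 1 / 2) (m : Fin N.M) (A : N.HopMatrix m) :
    N.hopProb m A = 1 / Fintype.card (N.HopMatrix m) := by
  have h : ∀ j i, (if A j i = 1 then N.p m j i else 1 - N.p m j i) = 1 / 2 := by
    intro j i
    rw [hp]
    split_ifs <;> norm_num
  rw [hopProb, card_binary_matrix]
  simp only [h, Finset.prod_const, Finset.card_univ, Fintype.card_fin]
  rw [← pow_mul, mul_comm]
  push_cast
  rw [one_div_pow]

theorem sum_rankLaw (b a : ℕ) :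
    ∑ r : Fin (a + 1), rankLaw (ZMod 2) b a r * (r : ℝ) =
      (∑ A : Matrix (Fin b) (Fin a) (ZMod 2), (A.rank : ℝ)) / 2 ^ (b * a) := by
  have h : ∑ A : Matrix (Fin b) (Fin a) (ZMod 2), (A.rank : ℝ) =
      ∑ r ∈ Finset.range (a + 1), ∑ A ∈ Finset.univ.filter
        fun A : Matrix (Fin b) (Fin a) (ZMod 2) => A.rank = r, (A.rank : ℝ) :=
    (Finset.sum_fiberwise_of_maps_to (fun A _ => Finset.mem_range.2
      (Nat.lt_succ_of_le A.rank_le_width)) _).symm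
  rw [Fin.sum_univ_eq_sum_range (fun r => rankLaw (ZMod 2) b a r * (r : ℝ)), h, Finset.sum_div]
  refine Finset.sum_congr rfl fun r _ => ?_
  rw [Finset.sum_congr rfl fun A hA => by rw [(Finset.mem_filter.1 hA).2], Finset.sum_const,
    nsmul_eq_mul, rankLaw, card_binary_matrix]
  push_cast
  ring

theorem rankLaw_eq_zero {b a r : ℕ} (h : min a b < r) : rankLaw (ZMod 2) b a r = 0 := by
  rw [rankLaw, Finset.filter_eq_empty_iff.2, Finset.card_empty, Nat.cast_zero, zero_div]
  intro A _ hA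
  have h1 := A.rank_le_width
  have h2 := A.rank_le_height
  omega

end RelayNetwork

/-! ### The weighting of packet types, and achievability. -/

namespace RelayNetwork

variable {N : RelayNetwork}

open scoped Classical in
/-- Any fraction of the mean of `r` is an achievable sum rate, provided that at every hop the
uniform channel matrix can be coupled with uniform ordered tuples of `r` receivers and `r`
transmitters that are connected by a uniform invertible matrix. -/
theorem exists_achievable_of_hopWeights (hM : 2 ≤ N.M) (hp : ∀ m j i, N.p m j i = 1 / 2)
    (s : ℕ) (ρ : ℕ → ℝ) (hρ : ∀ r, 0 ≤ ρ r)
    (hdim : ∀ r, ρ r ≠ 0 → ∀ m : Fin N.M, r ≤ N.K m ∧ r ≤ N.K (m + 1))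
    (w : (m : Fin N.M) → (r : ℕ) → N.HopMatrix m → (Fin r ↪ Fin (N.K (m + 1))) →
      (Fin r ↪ Fin (N.K m)) → ℝ)
    (hw : ∀ m r A e' e, 0 ≤ w m r A e' e)
    (hwsum : ∀ (m : Fin N.M) (r : ℕ) (e' : Fin r ↪ Fin (N.K (m + 1))) (e : Fin r ↪ Fin (N.K m))
      (G : (Matrix (Fin r) (Fin r) (ZMod 2))ˣ),
      (∑ A : N.HopMatrix m,
        if A.submatrix e' e = (G : Matrix (Fin r) (Fin r) (ZMod 2)) then w m r A e' e else 0) *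
        (Fintype.card (Fin r ↪ Fin (N.K (m + 1))) * Fintype.card (Fin r ↪ Fin (N.K m)) *
          Fintype.card (Matrix (Fin r) (Fin r) (ZMod 2))ˣ) = ρ r)
    (hwle : ∀ m A, ∑ r ∈ Finset.range s, ∑ e', ∑ e, w m r A e' e ≤
      1 / Fintype.card (N.HopMatrix m))
    {θ : ℝ} (hθ0 : 0 ≤ θ) (hθ1 : θ < 1) :
    ∃ R, N.Achievable R ∧ ∑ k, R k = θ * ∑ r : Fin s, ρ r * (r : ℝ) := by
  set Γ : ℕ → ℝ := fun r => (Fintype.card (Matrix (Fin r) (Fin r) (ZMod 2))ˣ : ℝ) with hΓ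
  have hΓ0 : ∀ r, 0 < Γ r := fun r => Nat.cast_pos.2 Fintype.card_pos
  set E : ℕ → ℕ → ℝ := fun r k => (Fintype.card (Fin r ↪ Fin k) : ℝ) with hE
  have hE0 : ∀ r, ρ r ≠ 0 → ∀ m : Fin N.M, 0 < E r (N.K m) ∧ 0 < E r (N.K (m + 1)) := by
    intro r hr m
    have h1 : Nonempty (Fin r ↪ Fin (N.K m)) := ⟨Fin.castLEEmb (hdim r hr m).1⟩
    have h2 : Nonempty (Fin r ↪ Fin (N.K (m + 1))) := ⟨Fin.castLEEmb (hdim r hr m).2⟩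
    exact ⟨Nat.cast_pos.2 Fintype.card_pos, Nat.cast_pos.2 Fintype.card_pos⟩
  set c : ℕ → ℕ → ℝ := fun r k => 1 / (E r k * Γ r) with hc
  have hcard : ∀ r k, (Fintype.card (LayerState r k) : ℝ) = E r k * Γ r := fun r k => by
    rw [Fintype.card_prod, Nat.cast_mul]
  have hcsum : ∀ r, ρ r ≠ 0 → ∀ l : Fin N.M,
      ∑ _y : LayerState r (N.K l), c r (N.K l) = 1 := by
    intro r hr l
    have := (hE0 r hr l).1.ne'
    have := (hΓ0 r).ne'
    rw [Finset.sum_const, Finset.card_univ, nsmul_eq_mul, hcard, hc]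
    field_simp
  -- The conditional law of the channel matrix given `r` and the states at both ends: `w` restricted
  -- to the prescribed block, divided by its total mass `ρ r / (E E Γ)` from `hwsum`.
  set κ : (r : ℕ) → (m : Fin N.M) → N.HopMatrix m → LayerState r (N.K (m + 1)) →
      LayerState r (N.K m) → ℝ := fun r m A y z =>
    (if A.submatrix y.1 z.1 = ((y.2 * z.2⁻¹ : (Matrix (Fin r) (Fin r) (ZMod 2))ˣ) :
      Matrix (Fin r) (Fin r) (ZMod 2)) then w m r A y.1 z.1 else 0) *
      (E r (N.K (m + 1)) * E r (N.K m) * Γ r) / ρ r with hκ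
  have hκ0 : ∀ r m A y z, 0 ≤ κ r m A y z := by
    intro r m A y z
    refine div_nonneg (mul_nonneg ?_ (by positivity)) (hρ r)
    split_ifs
    exacts [hw _ _ _ _ _, le_rfl]
  have hκsum : ∀ r, ρ r ≠ 0 → ∀ m y z, ∑ A, κ r m A y z = 1 := by
    intro r hr m y z
    simp only [hκ]
    rw [← Finset.sum_div, ← Finset.sum_mul, hwsum, div_self hr]
  have hκconn : ∀ r m A y z, κ r m A y z ≠ 0 → A.submatrix y.1 z.1 =
      ((y.2 * z.2⁻¹ : (Matrix (Fin r) (Fin r) (ZMod 2))ˣ) : Matrix (Fin r) (Fin r) (ZMod 2)) := by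
    intro r m A y z h
    by_contra hne
    refine h ?_
    simp only [hκ]
    rw [if_neg hne, zero_mul, zero_div]
  let T := Σ r : Fin s, (∀ l : Fin N.M, LayerState r (N.K l)) × (∀ m : Fin N.M, N.HopMatrix m)
  -- Joint law: `r` by `ρ`, then independent uniform layer states, then conditionally independent
  -- channel matrices.
  let q : T → ℝ := fun τ => ρ τ.1 * ((∏ l : Fin N.M, c τ.1 (N.K l)) *
    ∏ m, κ τ.1 m (τ.2.2 m) (nextLayer τ.2.1 m) (τ.2.1 m))
  have hc0 : ∀ r k, 0 ≤ c r k := fun r k => by positivity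
  have hq0 : ∀ τ, 0 ≤ q τ := fun τ => mul_nonneg (hρ _) (mul_nonneg
    (Finset.prod_nonneg fun l _ => hc0 _ _) (Finset.prod_nonneg fun m _ => hκ0 _ _ _ _ _))
  have hmarg : ∀ m a, (∑ τ : T, if τ.2.2 m = a then q τ else 0) ≤ N.hopProb m a := by
    intro m a
    rw [hopProb_of_half hp]
    refine le_trans ?_ (hwle m a)
    rw [← Fin.sum_univ_eq_sum_range (fun r => ∑ e', ∑ e, w m r a e' e), Fintype.sum_sigma]
    refine Finset.sum_le_sum fun r _ => ?_
    rw [Fintype.sum_prod_type]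
    rcases eq_or_ne (ρ r) 0 with hr | hr
    · have : ∀ x A, (if A m = a then q ⟨r, x, A⟩ else 0) = 0 := by
        intro x A
        simp [q, hr]
      simp only [this, Finset.sum_const_zero]
      exact Finset.sum_nonneg fun e' _ => Finset.sum_nonneg fun e _ => hw _ _ _ _ _
    have h1 : ∀ x : ∀ l : Fin N.M, LayerState r (N.K l),
        ∑ A : ∀ m : Fin N.M, N.HopMatrix m, (if A m = a then q ⟨r, x, A⟩ else 0) =
        (∏ l : Fin N.M, c r (N.K l)) * (ρ r * κ r m a (nextLayer x m) (x m)) := by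
      intro x
      have h2 := sum_prod_mul_apply (α := fun m : Fin N.M => N.HopMatrix m)
        (fun m A => κ r m A (nextLayer x m) (x m)) (fun m => hκsum r hr m _ _) m
        (fun A => if A = a then 1 else 0)
      simp only [mul_ite, mul_one, mul_zero, Finset.sum_ite_eq', Finset.mem_univ, if_true] at h2
      rw [← h2, Finset.mul_sum, Finset.mul_sum]
      refine Finset.sum_congr rfl fun A _ => ?_
      split_ifs
      · simp only [q]
        ring
      · simp
    simp only
    rw [Finset.sum_congr rfl fun x _ => h1 x,
      sum_nextLayer (X := LayerState r) hM (c r) (hcsum r hr) m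
        (fun y z => ρ r * κ r m a y z)]
    have h3 : ∀ (y : LayerState r (N.K (m + 1))) (z : LayerState r (N.K m)),
        c r (N.K (m + 1)) * c r (N.K m) * (ρ r * κ r m a y z) =
        (1 / Γ r) * (if a.submatrix y.1 z.1 =
          ((y.2 * z.2⁻¹ : (Matrix (Fin r) (Fin r) (ZMod 2))ˣ) : Matrix (Fin r) (Fin r) (ZMod 2))
          then w m r a y.1 z.1 else 0) := by
      intro y z
      have := (hE0 r hr m).1.ne'
      have := (hE0 r hr m).2.ne'
      have := (hΓ0 r).ne'
      simp only [hκ, hc]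
      field_simp
    simp only [h3]
    rw [Fintype.sum_prod_type]
    refine Finset.sum_le_sum fun e' _ => ?_
    simp only
    rw [Finset.sum_comm, Fintype.sum_prod_type]
    refine Finset.sum_le_sum fun e _ => ?_
    simp only
    -- Given `a` and `P`, at most one `P'` satisfies `P' P⁻¹ = a[e', e]`; averaging over `P` then
    -- returns at most `w`.
    have h4 : ∀ P : (Matrix (Fin r) (Fin r) (ZMod 2))ˣ,
        ∑ P' : (Matrix (Fin r) (Fin r) (ZMod 2))ˣ, (1 / Γ r) * (if a.submatrix e' e =
          ((P' * P⁻¹ : (Matrix (Fin r) (Fin r) (ZMod 2))ˣ) : Matrix (Fin r) (Fin r) (ZMod 2))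
          then w m r a e' e else 0) ≤ (1 / Γ r) * w m r a e' e := by
      intro P
      rw [← Finset.mul_sum]
      refine mul_le_mul_of_nonneg_left ?_ (by positivity)
      rw [← Finset.sum_filter, Finset.sum_const, nsmul_eq_mul]
      refine mul_le_of_le_one_left (hw _ _ _ _ _) ?_
      refine Nat.cast_le_one.2 (Finset.card_le_one.2 fun x hx y hy => ?_)
      have hxy := (Finset.mem_filter.1 hx).2.symm.trans (Finset.mem_filter.1 hy).2
      exact mul_right_cancel (Units.ext hxy)
    refine (Finset.sum_le_sum fun P _ => h4 P).trans ?_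
    rw [Finset.sum_const, Finset.card_univ, nsmul_eq_mul, ← mul_assoc, mul_one_div_cancel
      (hΓ0 r).ne', one_mul]
  have hfree : ∀ τ : T, q τ ≠ 0 → IsInterferenceFree τ.2.2 fun m => Set.range (τ.2.1 m).1 := by
    intro τ hτ
    refine isInterferenceFree_of_states _ _ fun m => hκconn _ _ _ _ _ fun h0 => hτ ?_
    have hz : ∏ m, κ τ.1 m (τ.2.2 m) (nextLayer τ.2.1 m) (τ.2.1 m) = 0 :=
      Finset.prod_eq_zero (Finset.mem_univ m) h0
    simp only [q]
    rw [hz, mul_zero, mul_zero]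
  refine ⟨_, achievable_of_packet_types (T := T) q hq0 hfree hmarg hθ0 hθ1, ?_⟩
  rw [← Finset.mul_sum, Finset.sum_comm]
  congr 1
  -- A packet of order `r` has exactly `r` active sources, so the sum rate is `θ` times the mean of
  -- `r`.
  have hcount : ∀ τ : T, (∑ k, if k ∈ Set.range (τ.2.1 ⟨0, N.M_pos⟩).1 then q τ else 0) =
      q τ * (τ.1 : ℝ) := by
    intro τ
    rw [← Finset.sum_filter, Finset.sum_const, nsmul_eq_mul, mul_comm]
    congr 2
    rw [show (Finset.univ.filter fun k => k ∈ Set.range (τ.2.1 ⟨0, N.M_pos⟩).1) =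
      Finset.univ.map (τ.2.1 ⟨0, N.M_pos⟩).1 by ext k; simp, Finset.card_map, Finset.card_univ,
      Fintype.card_fin]
  trans ∑ τ : T, q τ * (τ.1 : ℝ)
  · refine Finset.sum_congr rfl fun τ _ => ?_
    rw [← hcount τ]
    congr!
  rw [Fintype.sum_sigma]
  refine Finset.sum_congr rfl fun r _ => ?_
  simp only
  rw [← Finset.sum_mul, Fintype.sum_prod_type]
  congr 1
  rcases eq_or_ne (ρ r) 0 with hr | hr
  · simp [q, hr]
  simp only [q]
  simp only [← Finset.mul_sum]
  have h5 : ∀ x : ∀ l : Fin N.M, LayerState r (N.K l),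
      ∑ A : ∀ m : Fin N.M, N.HopMatrix m, ∏ m, κ r m (A m) (nextLayer x m) (x m) = 1 := by
    intro x
    rw [← Fintype.prod_sum (fun m A => κ r m A (nextLayer x m) (x m))]
    exact Finset.prod_eq_one fun m _ => hκsum r hr m _ _
  simp only [h5, Finset.mul_sum (Finset.univ : Finset (∀ l : Fin N.M, LayerState r (N.K l))),
    mul_one]
  rw [← Finset.mul_sum, ← Fintype.prod_sum (fun (l : Fin N.M) (_ : LayerState r (N.K l)) => c r (N.K l)),
    Finset.prod_eq_one fun l _ => hcsum r hr l, mul_one]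

/-- Achievability at a network with uniform channel matrices all of whose hops contain a
`b × a` or an `a × b` matrix. -/
theorem exists_achievable_sum_eq (hM : 2 ≤ N.M) (hp : ∀ m j i, N.p m j i = 1 / 2) (b a : ℕ)
    (hdim : ∀ m : Fin N.M, (a ≤ N.K m ∧ b ≤ N.K (m + 1)) ∨ (b ≤ N.K m ∧ a ≤ N.K (m + 1)))
    {θ : ℝ} (hθ0 : 0 ≤ θ) (hθ1 : θ < 1) :
    ∃ R, N.Achievable R ∧ ∑ k, R k =
      θ * ((∑ A : Matrix (Fin b) (Fin a) (ZMod 2), (A.rank : ℝ)) / 2 ^ (b * a)) := by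
  classical
  have hex : ∀ m : Fin N.M, ∃ w : (r : ℕ) → N.HopMatrix m → (Fin r ↪ Fin (N.K (m + 1))) →
      (Fin r ↪ Fin (N.K m)) → ℝ,
      (∀ r A e' e, 0 ≤ w r A e' e) ∧
      (∀ r (e' : Fin r ↪ Fin (N.K (m + 1))) (e : Fin r ↪ Fin (N.K m))
        (G : (Matrix (Fin r) (Fin r) (ZMod 2))ˣ),
        (∑ A : N.HopMatrix m,
          if A.submatrix e' e = (G : Matrix (Fin r) (Fin r) (ZMod 2)) then w r A e' e else 0) *
          (Fintype.card (Fin r ↪ Fin (N.K (m + 1))) * Fintype.card (Fin r ↪ Fin (N.K m)) *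
            Fintype.card (Matrix (Fin r) (Fin r) (ZMod 2))ˣ) = rankLaw (ZMod 2) b a r) ∧
      ∀ s A, ∑ r ∈ Finset.range s, ∑ e', ∑ e, w r A e' e ≤
        1 / Fintype.card (N.HopMatrix m) := by
    intro m
    rcases hdim m with h | h
    · obtain ⟨w, h0, h1, h2⟩ := exists_hopWeights (ZMod 2) h.2 h.1
      refine ⟨w, h0, fun r e' e G => ?_, h2⟩
      rw [← h1 r e' e G]
      congr!
    · obtain ⟨w, h0, h1, h2⟩ := exists_hopWeights (ZMod 2) h.2 h.1
      refine ⟨w, h0, fun r e' e G => ?_, h2⟩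
      rw [rankLaw_transpose, ← h1 r e' e G]
      congr!
  choose w hw0 hw1 hw2 using hex
  rw [← sum_rankLaw]
  refine exists_achievable_of_hopWeights hM hp (a + 1) (rankLaw (ZMod 2) b a)
    (fun r => by unfold rankLaw; positivity) (fun r hr m => ?_) w hw0 (fun m r e' e G => ?_)
    (fun m A => hw2 m (a + 1) A) hθ0 hθ1
  · have hle : r ≤ min a b := by
      by_contra! hlt
      exact hr (rankLaw_eq_zero hlt)
    have := le_min_iff.1 hle
    rcases hdim m with h | h <;> omega
  · rw [← hw1 m r e' e G]

theorem avgRank_of_half (hp : ∀ m j i, N.p m j i = 1 / 2) (m : Fin N.M) :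
    N.avgRank m = (∑ A : Matrix (Fin (N.K (m + 1))) (Fin (N.K m)) (ZMod 2), (A.rank : ℝ)) /
      2 ^ (N.K (m + 1) * N.K m) := by
  rw [avgRank, Finset.sum_div]
  refine Finset.sum_congr rfl fun A _ => ?_
  rw [hopProb_of_half hp, card_binary_matrix]
  push_cast
  ring

end RelayNetwork

/-! ### The sum capacity. -/

theorem corollary1 (N : RelayNetwork) (hM : 2 ≤ N.M)
    (hp : ∀ m j i, N.p m j i = 1 / 2)
    (m₀ : Fin N.M) (hm₀ : N.IsMinDimBottleneckHop m₀) :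
    N.IsSumCapacity
      ((∑ A : Matrix (Fin (N.K (m₀ + 1))) (Fin (N.K m₀)) (ZMod 2), (A.rank : ℝ)) /
        2 ^ (N.K (m₀ + 1) * N.K m₀)) ∧
    N.avgRank m₀ =
      (∑ A : Matrix (Fin (N.K (m₀ + 1))) (Fin (N.K m₀)) (ZMod 2), (A.rank : ℝ)) /
        2 ^ (N.K (m₀ + 1) * N.K m₀) := by
  have havg := RelayNetwork.avgRank_of_half hp m₀
  refine ⟨⟨?_, ?_⟩, havg⟩
  · rintro _ ⟨R, hR, rfl⟩
    rw [← havg]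
    exact hR.sum_le_avgRank m₀
  · intro U hU
    set C : ℝ := (∑ A : Matrix (Fin (N.K (m₀ + 1))) (Fin (N.K m₀)) (ZMod 2), (A.rank : ℝ)) /
      2 ^ (N.K (m₀ + 1) * N.K m₀)
    -- The value `C` itself need not be attained: any upper bound dominates `θ C` for every `θ < 1`,
    -- hence also the limit.
    have hθ : ∀ θ : ℝ, 0 ≤ θ → θ < 1 → θ * C ≤ U := by
      intro θ h0 h1
      obtain ⟨R, hR, hsum⟩ := RelayNetwork.exists_achievable_sum_eq hM hp (N.K (m₀ + 1)) (N.K m₀)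
        hm₀.2 h0 h1
      exact hU ⟨R, hR, hsum.symm⟩
    have hlim : Filter.Tendsto (fun n : ℕ => (1 - 1 / ((n : ℝ) + 1)) * C) Filter.atTop
        (nhds ((1 - 0) * C)) :=
      (tendsto_const_nhds.sub tendsto_one_div_add_atTop_nhds_zero_nat).mul_const C
    rw [sub_zero, one_mul] at hlim
    refine le_of_tendsto' hlim fun n => hθ _ ?_ ?_
    · rw [sub_nonneg, div_le_one (by positivity)]
      linarith [(Nat.cast_nonneg n : (0 : ℝ) ≤ n)]
    · linarith [(by positivity : (0 : ℝ) < 1 / ((n : ℝ) + 1))]
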